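/- Let $\Gamma$ be a Conway 99-graph, that is, a strongly regular graph with parameters $(99,14,1,2)$: a simple undirected graph with $99$ vertices in which every vertex has exactly $14$ neighbors, every two adjacent vertices have exactly $1$ common neighbor, and every two distinct non-adjacent vertices have exactly $2$ common neighbors. (Whether such a graph exists is an open problem.) Let $G=\mathrm{Aut}(\Gamma)$ be its full automorphism group. Then $|G|$ is not divisible by $14$. -/

import Mathlib

/-! Suppose 14 divides the order of the group. Local counting and a trace argument show that a
nontrivial involution fixes a single vertex x and swaps the ends of every edge inside N(x)
(`involution_structure`). An automorphism of order 7 also fixes a single vertex. An involution is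
therefore a product of 49 transpositions, an odd permutation, and a Frattini argument in the kernel
of the sign yields an involution τ normalizing a nontrivial 7-group. It fixes the vertex x fixed by
that group. Since an involution fixing x is determined by its forced action on N(x), τ commutes with
an element σ of order 7 (`exists_commuting`).

The cyclic group C generated by στ has order 14 and acts freely away from x: N(x) is one orbit, and
the 84 non-neighbours of x form six. Counting adjacencies between these six orbits gives a symmetric
matrix M over ℕ with even diagonal, row sums 12 and M² + M = 24J + 12I. There is also a parity
condition: N(x) is the union of two σ-orbits N₀ and τN₀, the non-neighbours with one neighbour in
each fill exactly three of the six orbits, and every non-neighbour has an even number of neighbours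
among them. A finite search (`search_rows`) excludes all these conditions together. -/

/-! ### Finite search for the 6 × 6 quotient matrix. -/

/-- Lists of `n` natural numbers with sum `s` and square sum `q`. -/
def tuplesWithSums : ℕ → ℕ → ℕ → List (List ℕ)
  | 0, s, q => if s = 0 ∧ q = 0 then [[]] else []
  | n + 1, s, q =>
    if s.ble q && (s * s).ble ((n + 1) * q) then
      (List.range (s + 1)).flatMap fun x =>
        if (x * x).ble q then (tuplesWithSums n (s - x) (q - x * x)).map (x :: ·) else []
    else []

theorem List.sum_le_sum_map_sq (l : List ℕ) : l.sum ≤ (l.map fun x => x * x).sum := by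
  induction l with
  | nil => simp
  | cons x l ih =>
    simp only [List.sum_cons, List.map_cons]
    nlinarith [Nat.le_mul_self x]

/-- Cauchy–Schwarz over ℕ. Together with x ≤ x², it shows that the pruning tests in `tuplesWithSums`
lose nothing. -/
theorem List.sum_mul_sum_le_length_mul (l : List ℕ) :
    l.sum * l.sum ≤ l.length * (l.map fun x => x * x).sum := by
  induction l with
  | nil => simp
  | cons x l ih =>
    simp only [List.sum_cons, List.map_cons, List.length_cons]
    generalize l.sum = s at *
    generalize (l.map fun x => x * x).sum = q at *
    generalize l.length = n at *
    have key : 2 * (x * s) ≤ n * (x * x) + q := by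
      rcases Nat.eq_zero_or_pos n with rfl | hn
      · have : s = 0 := by nlinarith
        simp [this]
      -- After multiplication by n, this is (s - nx)² ≥ 0 combined with s² ≤ nq.
      · zify at *
        have : (n : ℤ) * (2 * (x * s)) ≤ n * (n * (x * x) + q) := by
          nlinarith [sq_nonneg ((s : ℤ) - n * x)]
        exact le_of_mul_le_mul_left this hn
    nlinarith

/-- Completeness of the enumeration is all that is needed: superfluous tuples could only enlarge the
search. -/
theorem mem_tuplesWithSums (l : List ℕ) :
    l ∈ tuplesWithSums l.length l.sum (l.map fun x => x * x).sum := by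
  induction l with
  | nil => simp [tuplesWithSums]
  | cons x l ih =>
    have h1 := List.sum_le_sum_map_sq (x :: l)
    have h2 := List.sum_mul_sum_le_length_mul (x :: l)
    simp only [List.length_cons, tuplesWithSums]
    rw [if_pos (by simpa using ⟨h1, h2⟩), List.mem_flatMap]
    refine ⟨x, by simp, ?_⟩
    rw [if_pos (by simp)]
    simpa using ih

/-- Candidates for row `i` of a symmetric matrix of size six over `ℕ` with `M ^ 2 + M = 24 J + 12`
with row sums `12` and even diagonal. -/
def candidateRows (i : ℕ) : List (List ℕ) :=
  [0, 2, 4].flatMap fun m => (tuplesWithSums 6 12 (36 - m)).filter fun l => l.getD i 0 == m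

def listDot : List ℕ → List ℕ → ℕ
  | a :: l, b :: m => a * b + listDot l m
  | _, _ => 0

/-- Rows `r`, `s` at positions `i`, `j` fit into a symmetric matrix `M` with `M ^ 2 + M = 24` off
the diagonal. -/
def rowsFit (i j : ℕ) (r s : List ℕ) : Bool :=
  r.getD j 0 == s.getD i 0 && listDot r s + r.getD j 0 == 24

/-- Indicator lists of the three-element subsets of a six-element set. -/
def tripleIndicators : List (List ℕ) :=
  tuplesWithSums 6 3 3

def noEvenTriple (rows : List (List ℕ)) : Bool :=
  tripleIndicators.all fun t => rows.any fun r => listDot t r % 2 == 1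

/-- Entry 0 is exempt: in row 0 it is the diagonal entry, which stays in place when the other five
indices are permuted. -/
def tailSorted (l : List ℕ) : Bool :=
  l.getD 1 0 ≤ l.getD 2 0 && l.getD 2 0 ≤ l.getD 3 0 && l.getD 3 0 ≤ l.getD 4 0 &&
    l.getD 4 0 ≤ l.getD 5 0

-- Backtracking by rows: each row is tested against all earlier ones before the next is chosen,
-- which keeps the kernel evaluation small. The pattern `!p || q` encodes an implication.
set_option maxRecDepth 100000 in
theorem search_rows :
    ((candidateRows 0).all fun a => !tailSorted a ||
      (candidateRows 1).all fun b => !rowsFit 0 1 a b ||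
      (candidateRows 2).all fun c => !(rowsFit 0 2 a c && rowsFit 1 2 b c) ||
      (candidateRows 3).all fun d => !(rowsFit 0 3 a d && rowsFit 1 3 b d && rowsFit 2 3 c d) ||
      (candidateRows 4).all fun e =>
        !(rowsFit 0 4 a e && rowsFit 1 4 b e && rowsFit 2 4 c e && rowsFit 3 4 d e) ||
      (candidateRows 5).all fun f =>
        !(rowsFit 0 5 a f && rowsFit 1 5 b f && rowsFit 2 5 c f && rowsFit 3 5 d f &&
          rowsFit 4 5 e f) || noEvenTriple [a, b, c, d, e, f]) = true := by
  decide +kernel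

def finRow (v : Fin 6 → ℕ) : List ℕ := [v 0, v 1, v 2, v 3, v 4, v 5]

theorem mem_candidateRows {M : Fin 6 → Fin 6 → ℕ} (hrow : ∀ j, ∑ k, M j k = 12)
    (hsq : ∀ j, ∑ k, M j k * M j k + M j j = 36) (hdiag : ∀ j, Even (M j j)) (i : Fin 6) :
    finRow (M i) ∈ candidateRows i := by
  have h1 := hrow i
  have h2 := hsq i
  obtain ⟨c, hc⟩ := hdiag i
  have hle : M i i * M i i ≤ ∑ k, M i k * M i k :=
    Finset.single_le_sum (f := fun k => M i k * M i k) (fun _ _ => Nat.zero_le _)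
      (Finset.mem_univ i)
  -- A diagonal entry of at least 6 would contribute 6² + 6 > 36.
  have hc3 : c < 3 := by
    by_contra h
    have : 6 ≤ M i i := by omega
    nlinarith
  have hm := mem_tuplesWithSums (finRow (M i))
  have e1 : (finRow (M i)).sum = 12 := by
    rw [← h1]; simp [finRow, Fin.sum_univ_six]; ring
  have e2 : ((finRow (M i)).map fun x => x * x).sum = 36 - M i i := by
    rw [← h2, Nat.add_sub_cancel]; simp [finRow, Fin.sum_univ_six]; ring
  rw [e1, e2] at hm
  have hg : (finRow (M i)).getD i 0 = M i i := by fin_cases i <;> rfl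
  simp only [candidateRows, List.mem_flatMap, List.mem_filter]
  refine ⟨M i i, ?_, hm, by rw [hg]; exact beq_self_eq_true _⟩
  interval_cases c <;> simp [hc]

theorem listDot_finRow (v w : Fin 6 → ℕ) : listDot (finRow v) (finRow w) = ∑ k, v k * w k := by
  simp [finRow, listDot, Fin.sum_univ_six]; ring

theorem no_quotient_matrix_of_sorted {M : Fin 6 → Fin 6 → ℕ} (hsym : ∀ j k, M j k = M k j)
    (hrow : ∀ j, ∑ k, M j k = 12)
    (hsq : ∀ j l, ∑ k, M j k * M k l + M j l = 24 + if j = l then 12 else 0)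
    (hdiag : ∀ j, Even (M j j)) (t : Fin 6 → ℕ) (ht : ∀ j, t j ≤ 1) (ht3 : ∑ j, t j = 3)
    (hpar : ∀ j, Even (∑ k, t k * M j k)) (hmono : Monotone fun k : Fin 5 => M 0 k.succ) :
    False := by
  have hmem := mem_candidateRows hrow
    (fun j => by simpa [fun k => hsym k j] using hsq j j) hdiag
  have hfit : ∀ i j : Fin 6, i ≠ j → rowsFit i j (finRow (M i)) (finRow (M j)) = true := by
    intro i j hij
    have h := hsq i j
    simp only [hij, if_false, add_zero, fun k => hsym k j] at h
    have g : ∀ i j : Fin 6, (finRow (M i)).getD j 0 = M i j := by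
      intro i j; fin_cases j <;> rfl
    rw [rowsFit, g, g, listDot_finRow, hsym i j, h]
    simp
  have htail : tailSorted (finRow (M 0)) = true := by
    have m1 : M 0 1 ≤ M 0 2 := hmono (show (0 : Fin 5) ≤ 1 by decide)
    have m2 : M 0 2 ≤ M 0 3 := hmono (show (1 : Fin 5) ≤ 2 by decide)
    have m3 : M 0 3 ≤ M 0 4 := hmono (show (2 : Fin 5) ≤ 3 by decide)
    have m4 : M 0 4 ≤ M 0 5 := hmono (show (3 : Fin 5) ≤ 4 by decide)
    simp [tailSorted, finRow, m1, m2, m3, m4]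
  have htrip : finRow t ∈ tripleIndicators := by
    have h := mem_tuplesWithSums (finRow t)
    have e1 : (finRow t).sum = 3 := by
      rw [← ht3]; simp [finRow, Fin.sum_univ_six]; ring
    have e2 : ((finRow t).map fun x => x * x).sum = 3 := by
      rw [← ht3, Finset.sum_congr rfl fun j _ => show t j = t j * t j by
        have := ht j; interval_cases t j <;> rfl]
      simp [finRow, Fin.sum_univ_six]; ring
    rwa [e1, e2] at h
  have s := search_rows
  rw [List.all_eq_true] at s
  have s := s _ (hmem 0)
  rw [htail, Bool.not_true, Bool.false_or, List.all_eq_true] at s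
  have s := s _ (hmem 1)
  rw [show rowsFit 0 1 _ _ = true from hfit 0 1 (by decide), Bool.not_true, Bool.false_or,
    List.all_eq_true] at s
  have s := s _ (hmem 2)
  rw [show rowsFit 0 2 _ _ = true from hfit 0 2 (by decide),
    show rowsFit 1 2 _ _ = true from hfit 1 2 (by decide), Bool.and_true, Bool.not_true,
    Bool.false_or, List.all_eq_true] at s
  have s := s _ (hmem 3)
  rw [show rowsFit 0 3 _ _ = true from hfit 0 3 (by decide),
    show rowsFit 1 3 _ _ = true from hfit 1 3 (by decide),
    show rowsFit 2 3 _ _ = true from hfit 2 3 (by decide), Bool.and_true, Bool.and_true,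
    Bool.not_true, Bool.false_or, List.all_eq_true] at s
  have s := s _ (hmem 4)
  rw [show rowsFit 0 4 _ _ = true from hfit 0 4 (by decide),
    show rowsFit 1 4 _ _ = true from hfit 1 4 (by decide),
    show rowsFit 2 4 _ _ = true from hfit 2 4 (by decide),
    show rowsFit 3 4 _ _ = true from hfit 3 4 (by decide), Bool.and_true, Bool.and_true,
    Bool.and_true, Bool.not_true, Bool.false_or, List.all_eq_true] at s
  have s := s _ (hmem 5)
  rw [show rowsFit 0 5 _ _ = true from hfit 0 5 (by decide),
    show rowsFit 1 5 _ _ = true from hfit 1 5 (by decide),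
    show rowsFit 2 5 _ _ = true from hfit 2 5 (by decide),
    show rowsFit 3 5 _ _ = true from hfit 3 5 (by decide),
    show rowsFit 4 5 _ _ = true from hfit 4 5 (by decide), Bool.and_true, Bool.and_true,
    Bool.and_true, Bool.and_true, Bool.not_true, Bool.false_or] at s
  rw [noEvenTriple, List.all_eq_true] at s
  have s := s _ htrip
  have hev : ∀ j, listDot (finRow t) (finRow (M j)) % 2 = 0 := fun j => by
    rw [listDot_finRow]; exact Nat.even_iff.mp (hpar j)
  simp [hev] at s

theorem no_quotient_matrix {M : Fin 6 → Fin 6 → ℕ} (hsym : ∀ j k, M j k = M k j)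
    (hrow : ∀ j, ∑ k, M j k = 12)
    (hsq : ∀ j l, ∑ k, M j k * M k l + M j l = 24 + if j = l then 12 else 0)
    (hdiag : ∀ j, Even (M j j)) (t : Fin 6 → ℕ) (ht : ∀ j, t j ≤ 1) (ht3 : ∑ j, t j = 3)
    (hpar : ∀ j, Even (∑ k, t k * M j k)) : False := by
  -- All hypotheses survive a simultaneous permutation of rows and columns; this one fixes 0 and
  -- sorts the rest of row 0.
  let e : Equiv.Perm (Fin 6) :=
    Equiv.Perm.decomposeFin.symm (0, Tuple.sort fun k : Fin 5 => M 0 k.succ)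
  have e0 : e 0 = 0 := by simp [e]
  have es : ∀ k : Fin 5, e k.succ = (Tuple.sort (fun k : Fin 5 => M 0 k.succ) k).succ := by
    intro k; simp [e]
  refine no_quotient_matrix_of_sorted (M := fun j k => M (e j) (e k)) (fun j k => hsym _ _)
    (fun j => ?_) (fun j l => ?_) (fun j => hdiag _) (fun j => t (e j)) (fun j => ht _) ?_
    (fun j => ?_) ?_
  · rw [Equiv.sum_comp e (fun k => M (e j) k)]; exact hrow _
  · rw [Equiv.sum_comp e (fun k => M (e j) k * M k (e l)), hsq]; simp
  · rw [Equiv.sum_comp e t]; exact ht3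
  · rw [Equiv.sum_comp e (fun k => t k * M (e j) k)]; exact hpar _
  · have := Tuple.monotone_sort fun k : Fin 5 => M 0 k.succ
    simp only [e0, es]
    exact this

/-! ### Fixed points of maps of prime period. -/

theorem Finset.card_modEq_card_filter_fixed {α : Type*} [DecidableEq α] (S : Finset α) (f : α → α)
    (hf : ∀ a ∈ S, f a ∈ S) {p : ℕ} [hp : Fact p.Prime] (hpow : ∀ a ∈ S, f^[p] a = a) :
    S.card ≡ (S.filter fun a => f a = a).card [MOD p] := by
  let g : Function.End S := fun a => ⟨f a, hf a a.2⟩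
  have hg : ∀ (n : ℕ) (a : S), (((g ^ n : Function.End S) a : S) : α) = f^[n] a := by
    intro n
    induction n with
    | zero => intro a; rfl
    | succ n ih =>
      intro a
      rw [Function.iterate_succ_apply', ← ih, pow_succ']
      rfl
  have h1 : g ^ p ^ 1 = 1 := by
    funext a
    apply Subtype.ext
    rw [pow_one, hg, hpow _ a.2]
    rfl
  have := Equiv.Perm.card_fixedPoints_modEq (p := p) (n := 1) h1
  rw [Fintype.card_coe] at this
  convert this using 1
  rw [← Fintype.card_coe]
  refine Fintype.card_congr ⟨fun a => ⟨⟨a, (Finset.mem_filter.mp a.2).1⟩, ?_⟩,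
    fun a => ⟨a.1, Finset.mem_filter.mpr ⟨a.1.2, ?_⟩⟩, fun _ => rfl, fun _ => rfl⟩
  · exact Subtype.ext (Finset.mem_filter.mp a.2).2
  · exact congrArg Subtype.val a.2

theorem Finset.even_card_of_fixedPointFree {α : Type*} (S : Finset α) (f : α → α)
    (hf : ∀ a ∈ S, f a ∈ S) (hff : ∀ a ∈ S, f (f a) = a) (hne : ∀ a ∈ S, f a ≠ a) :
    Even S.card := by
  classical
  have := S.card_modEq_card_filter_fixed f hf (p := 2) (by simpa using hff)
  rw [Finset.filter_false_of_mem hne, Finset.card_empty] at this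
  exact Nat.even_iff.mpr this

/-! ### Local structure of the graph and automorphisms of order seven. -/

namespace SimpleGraph

variable {V : Type*} {Γ : SimpleGraph V}

theorem iso_adj_iff (g : Γ ≃g Γ) {u v : V} : Γ.Adj (g u) (g v) ↔ Γ.Adj u v := g.map_rel_iff

theorem iso_iterate (g : Γ ≃g Γ) (n : ℕ) (v : V) : g^[n] v = (g ^ n) v := by
  induction n with
  | zero => rfl
  | succ n ih => rw [Function.iterate_succ_apply', ih, pow_succ']; rfl

theorem iso_card_modEq [DecidableEq V] (g : Γ ≃g Γ) {p : ℕ} [Fact p.Prime] (hg : g ^ p = 1)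
    (S : Finset V) (hS : ∀ a ∈ S, g a ∈ S) : S.card ≡ (S.filter fun a => g a = a).card [MOD p] :=
  S.card_modEq_card_filter_fixed g hS fun a _ => by rw [iso_iterate, hg]; rfl

theorem iso_involutive_of_sq {τ : Γ ≃g Γ} (hτ : τ ^ 2 = 1) (v : V) : τ (τ v) = v := by
  have := congrArg (fun g : Γ ≃g Γ => g v) hτ
  rwa [pow_two] at this

variable [Fintype V] [DecidableRel Γ.Adj]

theorem IsSRGWith.card_inter [DecidableEq V] (hΓ : Γ.IsSRGWith 99 14 1 2) (u v : V) :
    (Γ.neighborFinset u ∩ Γ.neighborFinset v).card =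
      if u = v then 14 else if Γ.Adj u v then 1 else 2 := by
  have e : (Γ.neighborFinset u ∩ Γ.neighborFinset v).card =
      Fintype.card (Γ.commonNeighbors u v) := by
    rw [← Set.toFinset_card]
    congr 1
    ext w
    simp [mem_commonNeighbors]
  split_ifs with h1 h2
  · subst h1
    rw [Finset.inter_self]
    exact hΓ.regular u
  · rw [e, hΓ.of_adj u v h2]
  · rw [e, hΓ.of_not_adj h1 h2]

theorem IsSRGWith.exists_common_of_adj (hΓ : Γ.IsSRGWith 99 14 1 2) {u v : V} (h : Γ.Adj u v) :
    ∃ w, Γ.Adj u w ∧ Γ.Adj v w ∧ ∀ z, Γ.Adj u z → Γ.Adj v z → z = w := by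
  classical
  have hc := hΓ.card_inter u v
  rw [if_neg h.ne, if_pos h, Finset.card_eq_one] at hc
  obtain ⟨w, hw⟩ := hc
  simp only [Finset.ext_iff, Finset.mem_inter, mem_neighborFinset, Finset.mem_singleton] at hw
  exact ⟨w, ((hw w).2 rfl).1, ((hw w).2 rfl).2, fun z h1 h2 => (hw z).1 ⟨h1, h2⟩⟩

theorem IsSRGWith.eq_of_adj (hΓ : Γ.IsSRGWith 99 14 1 2) {u v w z : V} (h : Γ.Adj u v)
    (h1 : Γ.Adj u w) (h2 : Γ.Adj v w) (h3 : Γ.Adj u z) (h4 : Γ.Adj v z) : w = z := by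
  obtain ⟨t, -, -, ht⟩ := hΓ.exists_common_of_adj h
  rw [ht w h1 h2, ht z h3 h4]

theorem IsSRGWith.exists_common_of_not_adj (hΓ : Γ.IsSRGWith 99 14 1 2) {u v : V} (hne : u ≠ v)
    (h : ¬ Γ.Adj u v) :
    ∃ a b, a ≠ b ∧ Γ.Adj u a ∧ Γ.Adj v a ∧ Γ.Adj u b ∧ Γ.Adj v b ∧
      ∀ z, Γ.Adj u z → Γ.Adj v z → z = a ∨ z = b := by
  classical
  have hc := hΓ.card_inter u v
  rw [if_neg hne, if_neg h, Finset.card_eq_two] at hc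
  obtain ⟨a, b, hab, hw⟩ := hc
  simp only [Finset.ext_iff, Finset.mem_inter, mem_neighborFinset, Finset.mem_insert,
    Finset.mem_singleton] at hw
  exact ⟨a, b, hab, ((hw a).2 (.inl rfl)).1, ((hw a).2 (.inl rfl)).2, ((hw b).2 (.inr rfl)).1,
    ((hw b).2 (.inr rfl)).2, fun z h1 h2 => (hw z).1 ⟨h1, h2⟩⟩

/-- Two nonadjacent neighbours of `x` have exactly one further common neighbour, and it is not
adjacent to `x`. -/
theorem IsSRGWith.exists_opposite (hΓ : Γ.IsSRGWith 99 14 1 2) {x y z : V} (hy : Γ.Adj x y)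
    (hz : Γ.Adj x z) (hne : y ≠ z) (h : ¬ Γ.Adj y z) :
    ∃ v, v ≠ x ∧ Γ.Adj y v ∧ Γ.Adj z v ∧ ¬ Γ.Adj x v ∧
      ∀ w, Γ.Adj y w → Γ.Adj z w → w = x ∨ w = v := by
  obtain ⟨a, b, hab, ha1, ha2, hb1, hb2, hall⟩ := hΓ.exists_common_of_not_adj hne h
  have key : ∀ v, v ≠ x → Γ.Adj y v → Γ.Adj z v → ¬ Γ.Adj x v := by
    intro v hv h1 h2 h3
    exact hne (hΓ.eq_of_adj h3 hy h1.symm hz h2.symm)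
  rcases hall x hy.symm hz.symm with rfl | rfl
  · exact ⟨b, hab.symm, hb1, hb2, key b hab.symm hb1 hb2, hall⟩
  · exact ⟨a, hab, ha1, ha2, key a hab ha1 ha2, fun w h1 h2 => (hall w h1 h2).symm⟩

/-- The two common neighbours of nonadjacent vertices are nonadjacent. -/
theorem IsSRGWith.not_adj_of_common (hΓ : Γ.IsSRGWith 99 14 1 2) {u v a b : V} (hne : u ≠ v)
    (h1 : Γ.Adj u a) (h2 : Γ.Adj v a) (h3 : Γ.Adj u b) (h4 : Γ.Adj v b) : ¬ Γ.Adj a b :=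
  fun h => hne (hΓ.eq_of_adj h h1.symm h3.symm h2.symm h4.symm)

/-- A non-neighbour v of x is determined by its two neighbours a, b in N(x): the only common
neighbours of a and b are x and v. -/
theorem IsSRGWith.iso_eq_one_of_fixes_nbhd (hΓ : Γ.IsSRGWith 99 14 1 2) {g : Γ ≃g Γ} {x : V}
    (hx : g x = x) (hN : ∀ y, Γ.Adj x y → g y = y) : g = 1 := by
  ext v
  change g v = v
  by_cases hvx : v = x
  · rw [hvx, hx]
  by_cases hv : Γ.Adj x v
  · exact hN v hv
  obtain ⟨a, b, hab, ha1, ha2, hb1, hb2, -⟩ := hΓ.exists_common_of_not_adj (Ne.symm hvx) hv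
  have hnab := hΓ.not_adj_of_common (Ne.symm hvx) ha1 ha2 hb1 hb2
  obtain ⟨w, -, -, -, -, hw⟩ := hΓ.exists_opposite ha1 hb1 hab hnab
  have e1 := (hw v ha2.symm hb2.symm).resolve_left hvx
  have ga : Γ.Adj a (g v) := by
    have := (iso_adj_iff g).2 ha2.symm
    rwa [hN a ha1] at this
  have gb : Γ.Adj b (g v) := by
    have := (iso_adj_iff g).2 hb2.symm
    rwa [hN b hb1] at this
  rcases hw (g v) ga gb with h | h
  · exact absurd (g.injective (h.trans hx.symm)) hvx
  · rw [h, e1]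

/-- The fixed neighbours of a fixed vertex come in adjacent pairs. -/
theorem IsSRGWith.even_card_fixed_nbrs [DecidableEq V] (hΓ : Γ.IsSRGWith 99 14 1 2) {g : Γ ≃g Γ}
    {x : V} (hx : g x = x) : Even ((Γ.neighborFinset x).filter fun a => g a = a).card := by
  choose! f hf1 hf2 hf3 using fun (y : V) (h : Γ.Adj x y) => hΓ.exists_common_of_adj h
  refine Finset.even_card_of_fixedPointFree _ f ?_ ?_ ?_
  · simp only [Finset.mem_filter, mem_neighborFinset]
    rintro y ⟨hy, hgy⟩
    refine ⟨hf1 y hy, hf3 y hy _ ?_ ?_⟩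
    · have := (iso_adj_iff g).2 (hf1 y hy); rwa [hx] at this
    · have := (iso_adj_iff g).2 (hf2 y hy); rwa [hgy] at this
  · simp only [Finset.mem_filter, mem_neighborFinset]
    rintro y ⟨hy, -⟩
    exact (hf3 (f y) (hf1 y hy) y hy (hf2 y hy).symm).symm
  · simp only [Finset.mem_filter, mem_neighborFinset]
    rintro y ⟨hy, -⟩ h
    exact (hf2 y hy).ne h.symm

/-- An automorphism of order seven fixes exactly one vertex. -/
theorem IsSRGWith.existsUnique_fixed_of_pow_seven (hΓ : Γ.IsSRGWith 99 14 1 2) {g : Γ ≃g Γ}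
    (hg : g ^ 7 = 1) (hg1 : g ≠ 1) : ∃ x, g x = x ∧ ∀ y, g y = y → y = x := by
  classical
  have : Fact (Nat.Prime 7) := ⟨by norm_num⟩
  have h0 := iso_card_modEq g hg Finset.univ (by simp)
  rw [Finset.card_univ, hΓ.card] at h0
  have hpos : 0 < (Finset.univ.filter fun a => g a = a).card := by
    by_contra h
    rw [Nat.eq_zero_of_not_pos h] at h0
    exact absurd h0 (by decide)
  obtain ⟨x, hx⟩ := Finset.card_pos.mp hpos
  -- The number of fixed neighbours of a fixed vertex is even and divisible by 7, so it is 0 or 14,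
  -- and 14 forces g = 1.
  have hnone : ∀ x y, g x = x → g y = y → ¬ Γ.Adj x y := by
    intro x y hx hy hxy
    have hS : ∀ a ∈ Γ.neighborFinset x, g a ∈ Γ.neighborFinset x := by
      intro a ha
      rw [mem_neighborFinset] at ha ⊢
      have := (iso_adj_iff g).2 ha
      rwa [hx] at this
    have h1 := iso_card_modEq g hg _ hS
    have h2 := hΓ.even_card_fixed_nbrs hx
    have h14 : (Γ.neighborFinset x).card = 14 := hΓ.regular x
    have hle := Finset.card_filter_le (Γ.neighborFinset x) fun a => g a = a
    have hp : 0 < ((Γ.neighborFinset x).filter fun a => g a = a).card :=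
      Finset.card_pos.mpr ⟨y, by simp [hxy, hy]⟩
    rw [h14] at h1 hle
    have hall : ((Γ.neighborFinset x).filter fun a => g a = a).card = 14 := by
      obtain ⟨c, hc⟩ := h2
      unfold Nat.ModEq at h1
      omega
    have := Finset.filter_card_eq (hall.trans h14.symm)
    exact hg1 (hΓ.iso_eq_one_of_fixes_nbhd hx fun y hy => this y (by simpa using hy))
  rw [Finset.mem_filter] at hx
  refine ⟨x, hx.2, fun y hy => ?_⟩
  by_contra hyx
  -- The two common neighbours of two fixed vertices would be permuted with period 7, hence fixed,
  -- giving adjacent fixed vertices.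
  have hS : ∀ a ∈ Γ.neighborFinset x ∩ Γ.neighborFinset y,
      g a ∈ Γ.neighborFinset x ∩ Γ.neighborFinset y := by
    intro a ha
    simp only [Finset.mem_inter, mem_neighborFinset] at ha ⊢
    have h1 := (iso_adj_iff g).2 ha.1
    have h2 := (iso_adj_iff g).2 ha.2
    rw [hx.2] at h1
    rw [hy] at h2
    exact ⟨h1, h2⟩
  have h1 := iso_card_modEq g hg _ hS
  rw [hΓ.card_inter, if_neg (Ne.symm hyx), if_neg (hnone x y hx.2 hy)] at h1
  rw [Finset.filter_false_of_mem, Finset.card_empty] at h1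
  · exact absurd h1 (by decide)
  · intro a ha hga
    simp only [Finset.mem_inter, mem_neighborFinset] at ha
    exact hnone x a hx.2 hga ha.1

end SimpleGraph

/-! ### Arithmetic of the fixed-point counts of an involution. -/

/-- The numerical constraints satisfied by an involution force it to have one fixed point. -/
theorem card_eq_one_of_involution_counts {V : Type*} (F : Finset V) (p s n : V → ℕ) (r : ℕ)
    (hne : F.Nonempty) (hlt : F.card < 99) (hodd : Odd F.card)
    (hF : ∀ x ∈ F, F.card = 1 + 2 * (p x * p x) + n x) (h7 : ∀ x ∈ F, p x + s x + n x = 7)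
    (hle : F.card + 2 * ∑ x ∈ F, s x ≤ 99) (h3 : 3 ∣ ∑ x ∈ F, p x)
    (htr : 2 * F.card + ∑ x ∈ F, s x + 180 = 7 * r) : F.card = 1 := by
  obtain ⟨x₀, hx₀⟩ := hne
  -- In the application p, s, n are half the numbers of neighbours y of a fixed vertex that are
  -- fixed, moved to a neighbour of y, or moved to a non-neighbour of y.
  have hlin : ∀ a b c : ℕ, (∀ x ∈ F, s x + c = a * p x + b) →
      ∑ x ∈ F, s x + F.card * c = a * ∑ x ∈ F, p x + F.card * b := by
    intro a b c h
    have := Finset.sum_congr rfl h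
    simpa [Finset.sum_add_distrib, Finset.mul_sum] using this
  have hbd : ∀ B : ℕ, (∀ x ∈ F, p x ≤ B) → ∑ x ∈ F, p x ≤ F.card * B := by
    intro B h
    simpa using Finset.sum_le_card_nsmul F p B h
  have hb0 := h7 x₀ hx₀
  have hF0 := hF x₀ hx₀
  have hcard : F.card ∈ ({1, 3, 5, 7, 9, 11, 13, 19, 21, 23, 33, 35, 51, 53, 73} : Finset ℕ) := by
    have hp : p x₀ ≤ 7 := by omega
    have hn : n x₀ ≤ 7 - p x₀ := by omega
    obtain ⟨c, hc⟩ := hodd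
    rw [hc] at hF0 hlt ⊢
    generalize p x₀ = P at *
    generalize n x₀ = N at *
    interval_cases P <;> simp only [Finset.mem_insert, Finset.mem_singleton] <;> omega
  generalize hf : F.card = f at *
  have key : ∀ x ∈ F, p x ≤ 6 := by
    intro x hx
    have h1 := hF x hx
    have h2 := h7 x hx
    by_contra h
    have h3 : p x = 7 := by omega
    rw [h3] at h1
    omega
  have step : ∀ Q : ℕ → ℕ → Prop,
      (∀ P S N : ℕ, P ≤ 6 → f = 1 + 2 * (P * P) + N → P + S + N = 7 → Q P S) →
      ∀ x ∈ F, Q (p x) (s x) :=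
    fun Q h x hx => h _ _ _ (key x hx) (hF x hx) (h7 x hx)
  simp only [Finset.mem_insert, Finset.mem_singleton] at hcard
  -- For each value of f the admissible pairs (p, s) lie on one line s + c = a p + b. Summing over F
  -- expresses ∑ s through ∑ p; the bounds, divisibility by 3 and the trace condition modulo 7 then
  -- exclude every f > 1.
  rcases hcard with h | h | h | h | h | h | h | h | h | h | h | h | h | h | h
  · exact h
  · have l := hlin 1 5 0 (step (fun P S => S + 0 = 1 * P + 5) (by
      intro P S N hP h1 h2; interval_cases P <;> omega))
    have b := hbd 1 (step (fun P S => P ≤ 1) (by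
      intro P S N hP h1 h2; interval_cases P <;> omega))
    omega
  · have l := hlin 1 3 0 (step (fun P S => S + 0 = 1 * P + 3) (by
      intro P S N hP h1 h2; interval_cases P <;> omega))
    have b := hbd 1 (step (fun P S => P ≤ 1) (by
      intro P S N hP h1 h2; interval_cases P <;> omega))
    omega
  · have l := hlin 1 1 0 (step (fun P S => S + 0 = 1 * P + 1) (by
      intro P S N hP h1 h2; interval_cases P <;> omega))
    have b := hbd 1 (step (fun P S => P ≤ 1) (by
      intro P S N hP h1 h2; interval_cases P <;> omega))
    omega
  · have l := hlin 5 0 5 (step (fun P S => S + 5 = 5 * P + 0) (by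
      intro P S N hP h1 h2; interval_cases P <;> omega))
    have b := hbd 2 (step (fun P S => P ≤ 2) (by
      intro P S N hP h1 h2; interval_cases P <;> omega))
    omega
  · have l := hlin 0 3 0 (step (fun P S => S + 0 = 0 * P + 3) (by
      intro P S N hP h1 h2; interval_cases P <;> omega))
    omega
  · have l := hlin 0 1 0 (step (fun P S => S + 0 = 0 * P + 1) (by
      intro P S N hP h1 h2; interval_cases P <;> omega))
    omega
  · have l := hlin 0 4 0 (step (fun P S => S + 0 = 0 * P + 4) (by
      intro P S N hP h1 h2; interval_cases P <;> omega))
    omega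
  · have l := hlin 0 2 0 (step (fun P S => S + 0 = 0 * P + 2) (by
      intro P S N hP h1 h2; interval_cases P <;> omega))
    omega
  · have l := hlin 0 0 0 (step (fun P S => S + 0 = 0 * P + 0) (by
      intro P S N hP h1 h2; interval_cases P <;> omega))
    omega
  · have l := hlin 0 3 0 (step (fun P S => S + 0 = 0 * P + 3) (by
      intro P S N hP h1 h2; interval_cases P <;> omega))
    omega
  · have l := hlin 0 1 0 (step (fun P S => S + 0 = 0 * P + 1) (by
      intro P S N hP h1 h2; interval_cases P <;> omega))
    omega
  · have l := hlin 0 2 0 (step (fun P S => S + 0 = 0 * P + 2) (by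
      intro P S N hP h1 h2; interval_cases P <;> omega))
    omega
  · have l := hlin 0 0 0 (step (fun P S => S + 0 = 0 * P + 0) (by
      intro P S N hP h1 h2; interval_cases P <;> omega))
    omega
  · have l := hlin 0 1 0 (step (fun P S => S + 0 = 0 * P + 1) (by
      intro P S N hP h1 h2; interval_cases P <;> omega))
    omega

/-! ### Trace condition on an involution. -/

theorem Matrix.exists_trace_eq_natCast_of_isIdempotentElem {n K : Type*} [Fintype n]
    [DecidableEq n] [Field K] {M : Matrix n n K} (h : M * M = M) : ∃ r : ℕ, M.trace = r := by
  have h1 : IsIdempotentElem (Matrix.toLin' M) := by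
    change Matrix.toLin' M * Matrix.toLin' M = _
    rw [Module.End.mul_eq_comp, ← Matrix.toLin'_mul, h]
  rw [← Matrix.trace_toLin'_eq]
  exact ⟨_, (LinearMap.IsIdempotentElem.isProj_range _ h1).trace⟩

namespace SimpleGraph

variable {V : Type*} [Fintype V] {Γ : SimpleGraph V} [DecidableRel Γ.Adj]

theorem IsSRGWith.adjMatrix_mul_self [DecidableEq V] (hΓ : Γ.IsSRGWith 99 14 1 2) :
    Γ.adjMatrix ℚ * Γ.adjMatrix ℚ =
      (12 : ℚ) • (1 : Matrix V V ℚ) - Γ.adjMatrix ℚ + (2 : ℚ) • Matrix.of fun _ _ => 1 := by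
  ext u v
  have h := hΓ.card_inter u v
  have e : (Γ.adjMatrix ℚ * Γ.adjMatrix ℚ) u v =
      ((Γ.neighborFinset u ∩ Γ.neighborFinset v).card : ℚ) := by
    rw [Matrix.mul_apply, Finset.card_eq_sum_ones, Nat.cast_sum, ← Finset.filter_mem_eq_inter,
      Finset.sum_filter, neighborFinset_eq_filter, Finset.sum_filter]
    refine Finset.sum_congr rfl fun w _ => ?_
    simp only [adjMatrix_apply, mem_neighborFinset, Γ.adj_comm w v]
    split_ifs <;> simp
  rw [e, h]
  by_cases h1 : u = v
  · subst h1; simp; norm_num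
  · by_cases h2 : Γ.Adj u v
    · simp [h1, h2]; norm_num
    · simp [h1, h2]

/-- Here r is the dimension of the space of τ-invariant vectors in the eigenspace of A for the
eigenvalue 3: it is the trace of the product of two commuting projections. -/
theorem IsSRGWith.trace_constraint [DecidableEq V] (hΓ : Γ.IsSRGWith 99 14 1 2) {τ : Γ ≃g Γ}
    (hτ : ∀ v, τ (τ v) = v) :
    ∃ r : ℕ, 4 * (Finset.univ.filter fun v => τ v = v).card +
      (Finset.univ.filter fun v => Γ.Adj v (τ v)).card + 360 = 14 * r := by
  set A := Γ.adjMatrix ℚ with hA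
  set J : Matrix V V ℚ := Matrix.of fun _ _ => 1 with hJ
  set P : Matrix V V ℚ := Matrix.of fun u v => if τ u = v then 1 else 0 with hP
  have hAA : A * A = (12 : ℚ) • 1 - A + (2 : ℚ) • J := hΓ.adjMatrix_mul_self
  have hdeg : ∀ u, ∑ w, (if Γ.Adj u w then (1 : ℚ) else 0) = 14 := by
    intro u
    rw [Finset.sum_boole, ← neighborFinset_eq_filter, card_neighborFinset_eq_degree,
      hΓ.regular u]
    rfl
  have hAJ : A * J = (14 : ℚ) • J := by
    ext u v
    simp [hA, hJ, Matrix.mul_apply, hdeg]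
  have hJA : J * A = (14 : ℚ) • J := by
    ext u v
    simp [hA, hJ, Matrix.mul_apply, Γ.adj_comm _ v, hdeg]
  have hJJ : J * J = (99 : ℚ) • J := by
    ext u v
    simp [hJ, Matrix.mul_apply, hΓ.card]
  have hPP : P * P = 1 := by
    ext u v
    rw [Matrix.mul_apply, Finset.sum_eq_single (τ u)] <;>
      simp +contextual [hP, hτ, Matrix.one_apply, eq_comm]
  have hPA : P * A = A * P := by
    ext u v
    have : ∀ x, τ x = v ↔ x = τ v := fun x =>
      ⟨fun h => by rw [← h, hτ], fun h => by rw [h, hτ]⟩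
    have h2 : Γ.Adj (τ u) v ↔ Γ.Adj u (τ v) := by
      rw [← iso_adj_iff τ, hτ]
    have l : (P * A) u v = A (τ u) v := by
      simp only [hP, Matrix.mul_apply, Matrix.of_apply, ite_mul, one_mul, zero_mul,
        Finset.sum_ite_eq, Finset.mem_univ, if_true]
    have r : (A * P) u v = A u (τ v) := by
      simp only [hP, Matrix.mul_apply, Matrix.of_apply, this, mul_ite, mul_one, mul_zero,
        Finset.sum_ite_eq', Finset.mem_univ, if_true]
    rw [l, r]
    simp [hA, h2]
  have hPJ : P * J = J := by
    ext u v
    simp [hP, hJ, Matrix.mul_apply]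
  have hJP : J * P = J := by
    ext u v
    have : ∀ x, τ x = v ↔ x = τ v := fun x =>
      ⟨fun h => by rw [← h, hτ], fun h => by rw [h, hτ]⟩
    simp [hP, hJ, Matrix.mul_apply, this]
  -- The eigenvalues of A are 14, 3 and -4. This polynomial is 1 on the 3-eigenspace and 0 on the
  -- others: 7 = 3 + 4 and 2/11 = (14 + 4)/99.
  set E : Matrix V V ℚ := (1 / 7 : ℚ) • (A + (4 : ℚ) • 1 - (2 / 11 : ℚ) • J) with hE
  set Q : Matrix V V ℚ := (1 / 2 : ℚ) • (1 + P) with hQ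
  have hEE : E * E = E := by
    simp only [hE, smul_mul_assoc, mul_smul_comm, mul_add, add_mul, mul_sub, sub_mul, hAA, hAJ,
      hJA, hJJ, mul_one, one_mul]
    module
  have hQQ : Q * Q = Q := by
    simp only [hQ, smul_mul_assoc, mul_smul_comm, mul_add, add_mul, hPP, mul_one, one_mul]
    module
  have hQE : Q * E = E * Q := by
    simp only [hQ, hE, smul_mul_assoc, mul_smul_comm, mul_add, add_mul, mul_sub, sub_mul, hPA,
      hPJ, hJP, mul_one, one_mul]
    module
  have hEQ : (E * Q) * (E * Q) = E * Q := by
    rw [mul_assoc, ← mul_assoc Q, hQE, mul_assoc E Q Q, hQQ, ← mul_assoc, hEE]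
  obtain ⟨r, hr⟩ := Matrix.exists_trace_eq_natCast_of_isIdempotentElem hEQ
  refine ⟨r, ?_⟩
  have t1 : A.trace = 0 := by simp [hA]
  have t2 : J.trace = 99 := by simp [hJ, Matrix.trace, hΓ.card]
  have t3 : (1 : Matrix V V ℚ).trace = 99 := by simp [hΓ.card]
  have t4 : P.trace = ((Finset.univ.filter fun v => τ v = v).card : ℚ) := by
    simp [hP, Matrix.trace]
  have t5 : (A * P).trace = ((Finset.univ.filter fun v => Γ.Adj v (τ v)).card : ℚ) := by
    have : ∀ x v, τ x = v ↔ x = τ v := fun x v =>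
      ⟨fun h => by rw [← h, hτ], fun h => by rw [h, hτ]⟩
    simp [hP, hA, Matrix.trace, Matrix.mul_apply, this]
  have t6 : (E * Q).trace = (1 / 14 : ℚ) * ((0 + 4 * 99 - 2 / 11 * 99) + ((A * P).trace +
      4 * P.trace - 2 / 11 * 99)) := by
    rw [← t1]
    simp only [hE, hQ, smul_mul_assoc, mul_smul_comm, mul_add, add_mul, mul_sub, sub_mul, hJP,
      mul_one, one_mul, Matrix.trace_add, Matrix.trace_sub, Matrix.trace_smul, smul_eq_mul, t2,
      t3]
    ring
  rw [hr, t4, t5] at t6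
  have : (4 * (Finset.univ.filter fun v => τ v = v).card +
      (Finset.univ.filter fun v => Γ.Adj v (τ v)).card + 360 : ℚ) = 14 * r := by
    rw [t6]; ring
  exact_mod_cast this

end SimpleGraph

/-! ### Fixed vertices of an involution. -/

namespace SimpleGraph

variable {V : Type*} [Fintype V] [DecidableEq V] {Γ : SimpleGraph V} [DecidableRel Γ.Adj]

/-- A fixed z in N(x), not equal or adjacent to y, corresponds to the fourth vertex of the
quadrangle on y, x, z. The summand 2 accounts for y and the third vertex of the triangle on xy. -/
theorem IsSRGWith.card_fixed_nonadj_of_fixed (hΓ : Γ.IsSRGWith 99 14 1 2) {τ : Γ ≃g Γ}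
    {x y : V} (hx : τ x = x) (hy : τ y = y) (hxy : Γ.Adj x y) :
    (Finset.univ.filter fun v => (τ v = v ∧ v ≠ x ∧ ¬ Γ.Adj x v) ∧ Γ.Adj y v).card + 2 =
      ((Γ.neighborFinset x).filter fun z => τ z = z).card := by
  obtain ⟨y', hy1, hy2, hy3⟩ := hΓ.exists_common_of_adj hxy
  have hy' : τ y' = y' := by
    refine hy3 _ ?_ ?_
    · have := (iso_adj_iff τ).2 hy1; rwa [hx] at this
    · have := (iso_adj_iff τ).2 hy2; rwa [hy] at this
  have hZ : (Γ.neighborFinset x).filter (fun z => τ z = z) = insert y (insert y'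
      ((Γ.neighborFinset x).filter fun z => τ z = z ∧ z ≠ y ∧ ¬ Γ.Adj y z)) := by
    ext z
    simp only [Finset.mem_filter, mem_neighborFinset, Finset.mem_insert]
    constructor
    · rintro ⟨h1, h2⟩
      by_cases h3 : z = y
      · exact .inl h3
      by_cases h4 : Γ.Adj y z
      · exact .inr (.inl (hy3 z h1 h4))
      · exact .inr (.inr ⟨h1, h2, h3, h4⟩)
    · rintro (rfl | rfl | ⟨h1, h2, -⟩)
      exacts [⟨hxy, hy⟩, ⟨hy1, hy'⟩, ⟨h1, h2⟩]
  rw [hZ, Finset.card_insert_of_notMem, Finset.card_insert_of_notMem]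
  rotate_left
  · simp [hy2]
  · simp [hy2.ne]
  change _ = _ + 2
  congr 1
  symm
  choose! o ho1 ho2 ho3 ho4 ho5 using fun (z : V) (h : Γ.Adj x z ∧ y ≠ z ∧ ¬ Γ.Adj y z) =>
    hΓ.exists_opposite hxy h.1 h.2.1 h.2.2
  refine Finset.card_bij (fun z _ => o z) ?_ ?_ ?_
  · simp only [Finset.mem_filter, mem_neighborFinset, Finset.mem_univ, true_and]
    rintro z ⟨h1, h2, h3, h4⟩
    have hz : Γ.Adj x z ∧ y ≠ z ∧ ¬ Γ.Adj y z := ⟨h1, Ne.symm h3, h4⟩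
    refine ⟨⟨?_, ho1 z hz, ho4 z hz⟩, ho2 z hz⟩
    have e1 := (iso_adj_iff τ).2 (ho2 z hz)
    have e2 := (iso_adj_iff τ).2 (ho3 z hz)
    rw [hy] at e1
    rw [h2] at e2
    refine (ho5 z hz _ e1 e2).resolve_left fun h => ho1 z hz (τ.injective (h.trans hx.symm))
  · simp only [Finset.mem_filter, mem_neighborFinset]
    rintro z ⟨h1, h2, h3, h4⟩ w ⟨k1, k2, k3, k4⟩ hzw
    have hz : Γ.Adj x z ∧ y ≠ z ∧ ¬ Γ.Adj y z := ⟨h1, Ne.symm h3, h4⟩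
    have hw : Γ.Adj x w ∧ y ≠ w ∧ ¬ Γ.Adj y w := ⟨k1, Ne.symm k3, k4⟩
    obtain ⟨a, b, hab, -, -, -, -, hall⟩ :=
      hΓ.exists_common_of_not_adj (Ne.symm (ho1 z hz)) (ho4 z hz)
    have e1 := hall y hxy (ho2 z hz).symm
    have e2 := hall z h1 (ho3 z hz).symm
    have e3 := hall w k1 (by rw [hzw]; exact (ho3 w hw).symm)
    rcases e1 with rfl | rfl <;> rcases e2 with rfl | rfl <;> rcases e3 with rfl | rfl <;>
      first | rfl | exact absurd rfl h3 | exact absurd rfl k3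
  · simp only [Finset.mem_filter, mem_neighborFinset, Finset.mem_univ, true_and]
    rintro v ⟨⟨h1, h2, h3⟩, h4⟩
    obtain ⟨a, b, hab, ha1, ha2, hb1, hb2, hall⟩ := hΓ.exists_common_of_not_adj (Ne.symm h2) h3
    have hnab := hΓ.not_adj_of_common (Ne.symm h2) ha1 ha2 hb1 hb2
    have main : ∀ z, Γ.Adj x z → Γ.Adj v z → y ≠ z → ¬ Γ.Adj y z →
        (∀ w, Γ.Adj x w → Γ.Adj v w → w = z ∨ w = y) →
        ∃ z, ∃ (_ : Γ.Adj x z ∧ τ z = z ∧ z ≠ y ∧ ¬ Γ.Adj y z), o z = v := by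
      intro z z1 z2 z3 z4 z5
      refine ⟨z, ⟨z1, ?_, Ne.symm z3, z4⟩, ?_⟩
      · have e1 := (iso_adj_iff τ).2 z1
        have e2 := (iso_adj_iff τ).2 z2
        rw [hx] at e1
        rw [h1] at e2
        exact (z5 _ e1 e2).resolve_right fun h => z3 (τ.injective (h.trans hy.symm)).symm
      · exact ((ho5 z ⟨z1, z3, z4⟩ v h4 z2.symm).resolve_left h2).symm
    rcases hall y hxy h4.symm with rfl | rfl
    · exact main b hb1 hb2 hab hnab fun w w1 w2 => (hall w w1 w2).symm
    · exact main a ha1 ha2 hab.symm (fun h => hnab h.symm) fun w w1 w2 => hall w w1 w2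

/-- The number of fixed vertices of an involution, seen from a fixed vertex `x`. -/
theorem IsSRGWith.two_mul_card_fixed (hΓ : Γ.IsSRGWith 99 14 1 2) {τ : Γ ≃g Γ}
    (hτ : ∀ v, τ (τ v) = v) {x : V} (hx : τ x = x) {p : ℕ}
    (hp : ((Γ.neighborFinset x).filter fun y => τ y = y).card = p + p) :
    2 * (Finset.univ.filter fun v => τ v = v).card = 2 + 4 * (p * p) +
      ((Γ.neighborFinset x).filter fun y => τ y ≠ y ∧ ¬ Γ.Adj y (τ y)).card := by
  set S := Finset.univ.filter fun v => τ v = v ∧ v ≠ x ∧ ¬ Γ.Adj x v with hS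
  have hF : (Finset.univ.filter fun v => τ v = v).card = S.card + (p + p) + 1 := by
    rw [← hp, ← Finset.card_union_of_disjoint, ← Finset.card_insert_of_notMem (a := x)]
    · congr 1
      ext v
      simp only [hS, Finset.mem_filter, Finset.mem_univ, true_and, Finset.mem_insert,
        Finset.mem_union, mem_neighborFinset]
      constructor
      · intro h
        by_cases h1 : v = x <;> by_cases h2 : Γ.Adj x v <;> simp [h, h1, h2]
      · rintro (rfl | h | h)
        exacts [hx, h.1, h.2]
    · simp [hS]
    · rw [Finset.disjoint_left]
      intro v h1 h2
      simp only [hS, Finset.mem_filter, mem_neighborFinset] at h1 h2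
      exact h1.2.2.2 h2.1
  -- Edges between N(x) and the fixed non-neighbours of x are counted twice: two for each such
  -- non-neighbour, and by type of y in N(x).
  have h2S : ∑ v ∈ S, ((Γ.neighborFinset x).filter fun y => Γ.Adj y v).card = S.card * 2 := by
    rw [Finset.sum_const_nat]
    intro v hv
    simp only [hS, Finset.mem_filter] at hv
    have := hΓ.card_inter x v
    rw [if_neg (Ne.symm hv.2.2.1), if_neg hv.2.2.2] at this
    rw [← this]
    congr 1
    ext y
    simp [Γ.adj_comm v y]
  have hdc : ∑ v ∈ S, ((Γ.neighborFinset x).filter fun y => Γ.Adj y v).card =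
      ∑ y ∈ Γ.neighborFinset x, (S.filter fun v => Γ.Adj y v).card :=
    (Finset.sum_card_bipartiteAbove_eq_sum_card_bipartiteBelow fun y v => Γ.Adj y v).symm
  have hcase : ∀ y ∈ Γ.neighborFinset x, (S.filter fun v => Γ.Adj y v).card =
      if τ y = y then p + p - 2 else if ¬ Γ.Adj y (τ y) then 1 else 0 := by
    intro y hy
    rw [mem_neighborFinset] at hy
    split_ifs with h1 h2
    · have := hΓ.card_fixed_nonadj_of_fixed hx h1 hy
      rw [hp] at this
      rw [hS, Finset.filter_filter]
      omega
    · rw [Finset.card_eq_zero]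
      refine Finset.filter_false_of_mem fun w hw hyw => ?_
      simp only [hS, Finset.mem_filter] at hw
      have e := (iso_adj_iff τ).2 hyw
      have ex := (iso_adj_iff τ).2 hy.symm
      rw [hw.2.1] at e
      rw [hx] at ex
      exact hw.2.2.1 (hΓ.eq_of_adj h2 hyw e hy.symm ex)
    · have hy2 : Γ.Adj x (τ y) := by
        have := (iso_adj_iff τ).2 hy; rwa [hx] at this
      obtain ⟨v, v1, v2, v3, v4, v5⟩ := hΓ.exists_opposite hy hy2 (Ne.symm h1) h2
      rw [Finset.card_eq_one]
      refine ⟨v, ?_⟩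
      ext w
      simp only [hS, Finset.mem_filter, Finset.mem_univ, true_and, Finset.mem_singleton]
      constructor
      · rintro ⟨⟨w1, w2, w3⟩, w4⟩
        have := (iso_adj_iff τ).2 w4
        rw [w1] at this
        exact (v5 w w4 this).resolve_left w2
      · rintro rfl
        refine ⟨⟨?_, v1, v4⟩, v2⟩
        have e1 := (iso_adj_iff τ).2 v2
        have e2 := (iso_adj_iff τ).2 v3
        rw [hτ] at e2
        exact (v5 _ e2 e1).resolve_left fun h => v1 (τ.injective (h.trans hx.symm))
  rw [h2S, Finset.sum_congr rfl hcase, Finset.sum_ite, Finset.sum_const, hp, Finset.sum_ite,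
    Finset.sum_const_zero, Finset.sum_const, Finset.filter_filter] at hdc
  rw [hF]
  simp only [smul_eq_mul, mul_one] at hdc
  -- For p = 0 the truncated subtraction is harmless, its factor being 0.
  have : (p + p) * (p + p - 2) + 2 * (p + p) = 4 * (p * p) := by
    rcases Nat.eq_zero_or_pos p with rfl | hp0
    · rfl
    · obtain ⟨q, rfl⟩ : ∃ q, p = q + 1 := ⟨p - 1, by omega⟩
      have : q + 1 + (q + 1) - 2 = 2 * q := by omega
      rw [this]; ring
  simp only [ne_eq]
  omega

/-- If v and τ v are adjacent, their unique common neighbour is fixed and is the only fixed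
neighbour of v. -/
theorem IsSRGWith.card_adj_image (hΓ : Γ.IsSRGWith 99 14 1 2) {τ : Γ ≃g Γ}
    (hτ : ∀ v, τ (τ v) = v) :
    (Finset.univ.filter fun v => Γ.Adj v (τ v)).card =
      ∑ x ∈ Finset.univ.filter fun v => τ v = v,
        ((Γ.neighborFinset x).filter fun y => Γ.Adj y (τ y)).card := by
  have h1 : ∀ x, ((Γ.neighborFinset x).filter fun y => Γ.Adj y (τ y)) =
      (Finset.univ.filter fun v => Γ.Adj v (τ v)).filter fun y => Γ.Adj x y := by
    intro x; ext y; simp [and_comm]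
  simp only [h1]
  have := Finset.sum_card_bipartiteAbove_eq_sum_card_bipartiteBelow
    (s := Finset.univ.filter fun v => τ v = v) (t := Finset.univ.filter fun v => Γ.Adj v (τ v))
    (fun x y => Γ.Adj x y)
  simp only [Finset.bipartiteAbove, Finset.bipartiteBelow] at this
  rw [this, Finset.sum_const_nat (m := 1), mul_one]
  intro v hv
  simp only [Finset.mem_filter, Finset.mem_univ, true_and] at hv
  obtain ⟨w, w1, w2, w3⟩ := hΓ.exists_common_of_adj hv
  rw [Finset.card_eq_one]
  refine ⟨w, ?_⟩
  ext z
  simp only [Finset.mem_filter, Finset.mem_univ, true_and, Finset.mem_singleton]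
  constructor
  · rintro ⟨z1, z2⟩
    have := (iso_adj_iff τ).2 z2
    rw [z1] at this
    exact w3 z z2.symm this.symm
  · rintro rfl
    refine ⟨w3 _ ?_ ((iso_adj_iff τ).2 w1), w1.symm⟩
    have := (iso_adj_iff τ).2 w2
    rwa [hτ] at this

/-- Fixed vertices of an automorphism with fixed adjacent pairs span triangles. -/
theorem IsSRGWith.three_dvd_sum_fixed_nbrs (hΓ : Γ.IsSRGWith 99 14 1 2) (τ : Γ ≃g Γ) :
    3 ∣ ∑ x ∈ Finset.univ.filter fun v => τ v = v,
      ((Γ.neighborFinset x).filter fun y => τ y = y).card := by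
  rw [← Finset.card_sigma]
  have : Nonempty V := Fintype.card_pos_iff.mp (by rw [hΓ.card]; norm_num)
  choose! t ht1 ht2 ht3 using fun (q : V × V) (h : Γ.Adj q.1 q.2) => hΓ.exists_common_of_adj h
  set S := (Finset.univ.filter fun v => τ v = v).sigma
    fun x => (Γ.neighborFinset x).filter fun y => τ y = y with hS
  have hmem : ∀ q : (_ : V) × V, q ∈ S ↔ τ q.1 = q.1 ∧ Γ.Adj q.1 q.2 ∧ τ q.2 = q.2 := by
    intro q; simp [hS]
  have hstep : ∀ a b, Γ.Adj a b → t (b, t (a, b)) = a := fun a b h =>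
    (ht3 (b, t (a, b)) (ht2 (a, b) h) a h.symm (ht1 (a, b) h).symm).symm
  have : Fact (Nat.Prime 3) := ⟨by norm_num⟩
  -- Replacing (a, b) by (b, c), with c the third vertex of the triangle on ab, has period 3 and no
  -- fixed pair.
  have key := S.card_modEq_card_filter_fixed (fun q => ⟨q.2, t (q.1, q.2)⟩) (p := 3) ?_ ?_
  · rw [Finset.filter_false_of_mem, Finset.card_empty] at key
    · exact (Nat.modEq_zero_iff_dvd).mp key
    · rintro ⟨a, b⟩ hq h
      rw [hmem] at hq
      exact hq.2.1.ne (congrArg Sigma.fst h).symm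
  · rintro ⟨a, b⟩ hq
    rw [hmem] at hq ⊢
    obtain ⟨h1, h2, h3⟩ := hq
    dsimp only at h1 h2 h3 ⊢
    refine ⟨h3, ht2 (a, b) h2, ht3 (a, b) h2 _ ?_ ?_⟩
    · have := (iso_adj_iff τ).2 (ht1 (a, b) h2); rwa [h1] at this
    · have := (iso_adj_iff τ).2 (ht2 (a, b) h2); rwa [h3] at this
  · rintro ⟨a, b⟩ hq
    rw [hmem] at hq
    have h2 := hq.2.1
    dsimp only at h2
    simp only [Function.iterate_succ, Function.iterate_zero, Function.comp_apply, id]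
    have h4 := hstep b (t (a, b)) (ht2 (a, b) h2)
    rw [hstep a b h2] at h4 ⊢
    rw [h4]

/-- A nontrivial involution fixes exactly one vertex `x`, and swaps the ends of each edge in the
neighbourhood of `x`. -/
theorem IsSRGWith.involution_structure (hΓ : Γ.IsSRGWith 99 14 1 2) {τ : Γ ≃g Γ}
    (hτ : ∀ v, τ (τ v) = v) (hτ1 : τ ≠ 1) :
    ∃ x, τ x = x ∧ (∀ y, τ y = y → y = x) ∧ ∀ y, Γ.Adj x y → Γ.Adj y (τ y) := by
  set F := Finset.univ.filter fun v => τ v = v with hFdef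
  have hsq : τ ^ 2 = 1 := by ext v; rw [pow_two]; exact hτ v
  have hmod := iso_card_modEq τ hsq Finset.univ (by simp)
  rw [Finset.card_univ, hΓ.card] at hmod
  have hodd : Odd F.card := Nat.odd_iff.mpr hmod.symm
  have hle99 : F.card ≤ 99 := by
    rw [← hΓ.card]; exact Finset.card_le_univ F
  have hlt : F.card < 99 := by
    refine lt_of_le_of_ne hle99 fun h => hτ1 ?_
    rw [← hΓ.card, Finset.card_eq_iff_eq_univ] at h
    ext v
    exact (Finset.mem_filter.mp (h ▸ Finset.mem_univ v : v ∈ F)).2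
  choose! p hp using fun (x : V) (hx : τ x = x) => hΓ.even_card_fixed_nbrs hx
  have hbe : ∀ x, τ x = x →
      Even ((Γ.neighborFinset x).filter fun y => Γ.Adj y (τ y)).card := by
    intro x hx
    refine Finset.even_card_of_fixedPointFree _ τ ?_ (fun a _ => hτ a) ?_
    · simp only [Finset.mem_filter, mem_neighborFinset]
      rintro y ⟨h1, h2⟩
      have h3 := (iso_adj_iff τ).2 h1
      rw [hx] at h3
      exact ⟨h3, (iso_adj_iff τ).2 h2⟩
    · simp only [Finset.mem_filter]
      rintro y ⟨-, h2⟩ h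
      exact h2.ne h.symm
  choose! s hs using hbe
  have hsplit : ∀ x, τ x = x → (p x + p x) + (s x + s x) +
      ((Γ.neighborFinset x).filter fun y => τ y ≠ y ∧ ¬ Γ.Adj y (τ y)).card = 14 := by
    intro x hx
    have h14 : (Γ.neighborFinset x).card = 14 := hΓ.regular x
    rw [← hp x hx, ← hs x hx, add_assoc, ← h14,
      ← Finset.card_filter_add_card_filter_not (s := Γ.neighborFinset x) (fun y => τ y = y),
      ← Finset.card_filter_add_card_filter_not
        (s := (Γ.neighborFinset x).filter fun y => ¬ τ y = y) (fun y => Γ.Adj y (τ y)),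
      Finset.filter_filter, Finset.filter_filter]
    congr 3
    refine Finset.filter_congr fun y _ => ?_
    exact ⟨fun h => ⟨h.ne', h⟩, fun h => h.2⟩
  have hcount : ∀ x, τ x = x → 2 * F.card = 2 + 4 * (p x * p x) +
      ((Γ.neighborFinset x).filter fun y => τ y ≠ y ∧ ¬ Γ.Adj y (τ y)).card :=
    fun x hx => hΓ.two_mul_card_fixed hτ hx (hp x hx)
  have hadj := hΓ.card_adj_image hτ
  have hsum : ∑ x ∈ F, ((Γ.neighborFinset x).filter fun y => Γ.Adj y (τ y)).card =
      2 * ∑ x ∈ F, s x := by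
    rw [Finset.mul_sum]
    refine Finset.sum_congr rfl fun x hx => ?_
    rw [hs x (Finset.mem_filter.mp hx).2, two_mul]
  have hsum3 := hΓ.three_dvd_sum_fixed_nbrs τ
  have hsum3' : ∑ x ∈ F, ((Γ.neighborFinset x).filter fun y => τ y = y).card =
      2 * ∑ x ∈ F, p x := by
    rw [Finset.mul_sum]
    refine Finset.sum_congr rfl fun x hx => ?_
    rw [hp x (Finset.mem_filter.mp hx).2, two_mul]
  obtain ⟨r, hr⟩ := hΓ.trace_constraint hτ
  rw [← hFdef] at hr hadj
  have hdisj : F.card + (Finset.univ.filter fun v => Γ.Adj v (τ v)).card ≤ 99 := by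
    rw [← hΓ.card, ← Finset.card_union_of_disjoint]
    · exact Finset.card_le_univ _
    · rw [Finset.disjoint_left]
      intro v h1 h2
      simp only [hFdef, Finset.mem_filter, Finset.mem_univ, true_and] at h1 h2
      exact h2.ne h1.symm
  rw [hsum] at hadj
  rw [hsum3'] at hsum3
  have hne : F.Nonempty := Finset.card_pos.mp hodd.pos
  have hone := card_eq_one_of_involution_counts F p s (fun x => 7 - p x - s x) r hne hlt hodd
    (fun x hx => by
      have h1 := hcount x (Finset.mem_filter.mp hx).2
      have h2 := hsplit x (Finset.mem_filter.mp hx).2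
      omega)
    (fun x hx => by
      have h2 := hsplit x (Finset.mem_filter.mp hx).2
      omega)
    (by omega) (by omega) (by omega)
  obtain ⟨x, hxF⟩ := Finset.card_eq_one.mp hone
  have hx : τ x = x :=
    (Finset.mem_filter.mp (hxF ▸ Finset.mem_singleton_self x : x ∈ F)).2
  refine ⟨x, hx, fun y hy => ?_, fun y hy => ?_⟩
  · have : y ∈ F := by simp [hFdef, hy]
    rwa [hxF, Finset.mem_singleton] at this
  -- With a single fixed vertex, the count leaves no fixed neighbour and no neighbour moved to a
  -- non-neighbour of itself.
  · have h1 := hcount x hx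
    have h2 := hsplit x hx
    have hs7 : ((Γ.neighborFinset x).filter fun y => Γ.Adj y (τ y)).card = 14 := by
      rw [hs x hx]
      have : p x * p x = 0 := by omega
      have : p x = 0 := by simpa using this
      omega
    have h14 : (Γ.neighborFinset x).card = 14 := hΓ.regular x
    exact Finset.filter_card_eq (hs7.trans h14.symm) y (by simpa using hy)

end SimpleGraph

/-! ### Sign of automorphisms and a commuting pair of orders two and seven. -/

namespace SimpleGraph

variable {V : Type*} {Γ : SimpleGraph V}

/-- The sign of an automorphism as a permutation of the vertices. -/
def isoSign [Fintype V] [DecidableEq V] (Γ : SimpleGraph V) : (Γ ≃g Γ) →* ℤˣ :=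
  Equiv.Perm.sign.comp
    { toFun := fun g => g.toEquiv
      map_one' := rfl
      map_mul' := fun _ _ => rfl }

variable [Fintype V] [DecidableEq V] [DecidableRel Γ.Adj]

theorem IsSRGWith.isoSign_involution (hΓ : Γ.IsSRGWith 99 14 1 2) {τ : Γ ≃g Γ}
    (hτ : τ ^ 2 = 1) (hτ1 : τ ≠ 1) : isoSign Γ τ = -1 := by
  have h := iso_involutive_of_sq hτ
  obtain ⟨x, hx, hx1, -⟩ := hΓ.involution_structure h hτ1
  have hsq : τ.toEquiv ^ 2 = 1 := by
    ext v
    rw [pow_two]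
    exact h v
  change Equiv.Perm.sign τ.toEquiv = -1
  have hc : Fintype.card (Function.fixedPoints τ.toEquiv) = 1 :=
    Fintype.card_eq_one_iff.mpr ⟨⟨x, hx⟩, fun y => Subtype.ext (hx1 y y.2)⟩
  rw [Equiv.Perm.sign_of_pow_two_eq_one hsq, hΓ.card, hc]
  rfl

/-- Both τ and its conjugate by σ are involutions fixing x, so both send each neighbour y of x to
the third vertex of the triangle on xy. They agree on N(x), hence everywhere. -/
theorem IsSRGWith.involution_comm_of_fixed (hΓ : Γ.IsSRGWith 99 14 1 2) {σ τ : Γ ≃g Γ}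
    (hτ : ∀ v, τ (τ v) = v) (hτ1 : τ ≠ 1) {x : V} (hσx : σ x = x) (hτx : τ x = x) :
    σ * τ = τ * σ := by
  have key : ∀ ρ : Γ ≃g Γ, (∀ v, ρ (ρ v) = v) → ρ ≠ 1 → ρ x = x →
      ∀ y, Γ.Adj x y → Γ.Adj y (ρ y) := by
    intro ρ h h1 hx y hy
    obtain ⟨z, -, hz1, hz2⟩ := hΓ.involution_structure h h1
    rw [← hz1 x hx] at hz2
    exact hz2 y hy
  have hinv : ∀ v, σ (σ⁻¹ v) = v := RelIso.apply_inv_self σ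
  have hinv' : ∀ v, σ⁻¹ (σ v) = v := RelIso.inv_apply_self σ
  set ρ : Γ ≃g Γ := σ * τ * σ⁻¹ with hρ
  have hρv : ∀ v, ρ v = σ (τ (σ⁻¹ v)) := fun _ => rfl
  have hρ1 : ρ ≠ 1 := by
    intro h
    apply hτ1
    rwa [hρ, conj_eq_one_iff] at h
  have hρx : ρ x = x := by
    have : σ⁻¹ x = x := by have := hinv' x; rwa [hσx] at this
    rw [hρv, this, hτx, hσx]
  have h1 := key τ hτ hτ1 hτx
  have h2 := key ρ (fun v => by rw [hρv, hρv, hinv', hτ, hinv]) hρ1 hρx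
  have heq : ∀ y, Γ.Adj x y → ρ y = τ y := by
    intro y hy
    have a1 := (iso_adj_iff ρ).2 hy
    have a2 := (iso_adj_iff τ).2 hy
    rw [hρx] at a1
    rw [hτx] at a2
    exact hΓ.eq_of_adj hy a1 (h2 y hy) a2 (h1 y hy)
  have hone : ρ * τ = 1 := by
    refine hΓ.iso_eq_one_of_fixes_nbhd (x := x) ?_ ?_
    · change ρ (τ x) = x
      rw [hτx, hρx]
    · intro y hy
      have a2 := (iso_adj_iff τ).2 hy
      rw [hτx] at a2
      change ρ (τ y) = y
      rw [heq _ a2, hτ]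
  have hττ : τ * τ = 1 := by ext v; exact hτ v
  have : ρ = τ := mul_right_cancel (hone.trans hττ.symm)
  rw [hρ, mul_inv_eq_iff_eq_mul] at this
  exact this

/-- If `14` divides the order of the automorphism group, then there are commuting automorphisms
of orders two and seven. -/
theorem IsSRGWith.exists_commuting (hΓ : Γ.IsSRGWith 99 14 1 2)
    (h14 : 14 ∣ Nat.card (Γ ≃g Γ)) :
    ∃ (x : V) (σ τ : Γ ≃g Γ), σ x = x ∧ τ x = x ∧ σ ^ 7 = 1 ∧ σ ≠ 1 ∧ τ ^ 2 = 1 ∧ τ ≠ 1 ∧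
      σ * τ = τ * σ ∧ ∀ y, Γ.Adj x y → Γ.Adj y (τ y) := by
  have : Fact (Nat.Prime 7) := ⟨by norm_num⟩
  have : Fact (Nat.Prime 2) := ⟨by norm_num⟩
  have : Finite (Γ ≃g Γ) := DFunLike.finite _
  set H := (isoSign Γ).ker with hH
  obtain ⟨τ₀, hτ₀⟩ := exists_prime_orderOf_dvd_card' (G := Γ ≃g Γ) 2
    (dvd_trans (by norm_num) h14)
  obtain ⟨σ₀, hσ₀⟩ := exists_prime_orderOf_dvd_card' (G := Γ ≃g Γ) 7
    (dvd_trans (by norm_num) h14)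
  have hτ₀s : isoSign Γ τ₀ = -1 := by
    refine hΓ.isoSign_involution (by rw [← hτ₀]; exact pow_orderOf_eq_one τ₀) ?_
    rintro rfl
    simp at hτ₀
  have hσ₀H : σ₀ ∈ H := by
    rw [hH, MonoidHom.mem_ker]
    have h7 : isoSign Γ σ₀ ^ 7 = 1 := by
      rw [← map_pow, ← hσ₀, pow_orderOf_eq_one, map_one]
    rcases Int.units_eq_one_or (isoSign Γ σ₀) with h | h
    · exact h
    · rw [h] at h7
      exact absurd h7 (by decide)
  have h7H : 7 ∣ Nat.card H := by
    have : orderOf (⟨σ₀, hσ₀H⟩ : H) = 7 := by rw [Subgroup.orderOf_mk, hσ₀]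
    rw [← this]
    exact orderOf_dvd_natCard _
  let P : Sylow 7 H := default
  obtain ⟨σ₁, hσ₁⟩ := exists_prime_orderOf_dvd_card' (G := P) 7 (P.dvd_card_of_dvd_card h7H)
  set Q : Subgroup (Γ ≃g Γ) := (P : Subgroup H).map H.subtype with hQ
  -- Frattini argument: as τ₀ lies outside the kernel H, the normalizer of Q cannot lie inside it.
  -- An odd element of the normalizer has even order, so one of its powers is an involution.
  have hsup : Subgroup.normalizer (Q : Set (Γ ≃g Γ)) ⊔ H = ⊤ := P.normalizer_sup_eq_top
  obtain ⟨n, hn, hns⟩ : ∃ n ∈ Subgroup.normalizer (Q : Set (Γ ≃g Γ)), isoSign Γ n = -1 := by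
    by_contra! h
    have hle : Subgroup.normalizer (Q : Set (Γ ≃g Γ)) ≤ H := fun n hn =>
      (Int.units_eq_one_or _).resolve_right (h n hn)
    have hmem : τ₀ ∈ H := by
      rw [sup_eq_right.mpr hle] at hsup
      rw [hsup]
      trivial
    rw [hH, MonoidHom.mem_ker, hτ₀s] at hmem
    exact absurd hmem (by decide)
  have heven : Even (orderOf n) := by
    by_contra h
    have h1 : isoSign Γ n ^ orderOf n = 1 := by
      rw [← map_pow, pow_orderOf_eq_one, map_one]
    rw [hns, (Nat.not_even_iff_odd.mp h).neg_one_pow] at h1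
    exact absurd h1 (by decide)
  obtain ⟨m, hm⟩ := heven
  have hpos := orderOf_pos n
  set τ := n ^ m with hτdef
  have hτ2 : τ ^ 2 = 1 := by
    rw [hτdef, ← pow_mul, mul_two, ← hm, pow_orderOf_eq_one]
  have hτ1 : τ ≠ 1 := pow_ne_one_of_lt_orderOf (by omega) (by omega)
  have hτn : τ ∈ Subgroup.normalizer (Q : Set (Γ ≃g Γ)) := pow_mem hn m
  have hττ := iso_involutive_of_sq hτ2
  set σ : Γ ≃g Γ := ((σ₁ : H) : Γ ≃g Γ) with hσdef
  have hσQ : σ ∈ Q := Subgroup.mem_map_of_mem _ σ₁.2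
  have hσo : orderOf σ = 7 := by rw [hσdef, Subgroup.orderOf_coe, Subgroup.orderOf_coe, hσ₁]
  have hσ7 : σ ^ 7 = 1 := by rw [← hσo, pow_orderOf_eq_one]
  have hσ1 : σ ≠ 1 := by
    intro h
    rw [h] at hσo
    simp at hσo
  have hQp : IsPGroup 7 Q := P.isPGroup'.map _
  obtain ⟨x, hxfix⟩ := hQp.nonempty_fixed_point_of_prime_not_dvd_card V (by
    rw [Nat.card_eq_fintype_card, hΓ.card]; norm_num)
  have hQx : ∀ q ∈ Q, q x = x := fun q hq => hxfix ⟨q, hq⟩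
  obtain ⟨x', hx', hx'1⟩ := hΓ.existsUnique_fixed_of_pow_seven hσ7 hσ1
  -- The conjugate of σ by τ⁻¹ lies in Q and so fixes x; thus σ fixes τ x, and its fixed vertex is
  -- unique.
  have hτx : τ x = x := by
    have hq : τ⁻¹ * σ * τ⁻¹⁻¹ ∈ Q :=
      (Subgroup.mem_normalizer_iff.mp (inv_mem hτn) σ).mp hσQ
    have h1 := hQx _ hq
    rw [inv_inv] at h1
    have h2 : τ⁻¹ (σ (τ x)) = x := h1
    have h3 : σ (τ x) = τ x := by
      have := congrArg τ h2
      rwa [RelIso.apply_inv_self] at this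
    exact (hx'1 _ h3).trans (hx'1 x (hQx σ hσQ)).symm
  refine ⟨x, σ, τ, hQx σ hσQ, hτx, hσ7, hσ1, hτ2, hτ1,
    hΓ.involution_comm_of_fixed hττ hτ1 (hQx σ hσQ) hτx, ?_⟩
  obtain ⟨z, -, hz1, hz2⟩ := hΓ.involution_structure hττ hτ1
  rwa [← hz1 x hτx] at hz2

end SimpleGraph

/-! ### Orbits of a free action and counts around a fixed vertex. -/

theorem Finset.exists_orbit_reps {G α : Type*} [Group G] [Fintype G] [MulAction G α]
    [DecidableEq α] (k : ℕ) (W : Finset α) (hinv : ∀ (g : G), ∀ w ∈ W, g • w ∈ W)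
    (hfree : ∀ w ∈ W, ∀ g : G, g • w = w → g = 1) (hW : W.card = k * Fintype.card G) :
    ∃ r : Fin k → α, (∀ j, r j ∈ W) ∧
      ∀ f : α → ℕ, ∑ w ∈ W, f w = ∑ j, ∑ g : G, f (g • r j) := by
  induction k generalizing W with
  | zero =>
    rw [zero_mul, Finset.card_eq_zero] at hW
    subst hW
    exact ⟨Fin.elim0, fun j => j.elim0, fun f => by simp⟩
  | succ k ih =>
    have hpos : 0 < W.card := by
      rw [hW]; exact Nat.mul_pos k.succ_pos Fintype.card_pos
    obtain ⟨w, hw⟩ := Finset.card_pos.mp hpos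
    have hinj : Function.Injective fun g : G => g • w := by
      intro g h hgh
      have : (h⁻¹ * g) • w = w := by
        rw [mul_smul, inv_smul_eq_iff]; exact hgh
      exact (inv_mul_eq_one.mp (hfree w hw _ this)).symm
    set O := Finset.univ.image fun g : G => g • w with hO
    have hOW : O ⊆ W := by
      intro v hv
      obtain ⟨g, -, rfl⟩ := Finset.mem_image.mp hv
      exact hinv g w hw
    have hOc : O.card = Fintype.card G := by
      rw [hO, Finset.card_image_of_injective _ hinj, Finset.card_univ]
    have hinv' : ∀ (g : G), ∀ v ∈ W \ O, g • v ∈ W \ O := by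
      intro g v hv
      rw [Finset.mem_sdiff] at hv ⊢
      refine ⟨hinv g v hv.1, fun h => hv.2 ?_⟩
      obtain ⟨h, -, hh⟩ := Finset.mem_image.mp h
      refine Finset.mem_image.mpr ⟨g⁻¹ * h, Finset.mem_univ _, ?_⟩
      rw [mul_smul, hh, inv_smul_smul]
    have hcard : (W \ O).card = k * Fintype.card G := by
      rw [Finset.card_sdiff_of_subset hOW, hW, hOc, Nat.succ_mul, Nat.add_sub_cancel]
    obtain ⟨r, hr, hsum⟩ :=
      ih (W \ O) hinv' (fun v hv => hfree v (Finset.mem_sdiff.mp hv).1) hcard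
    refine ⟨Fin.cons w r, fun j => ?_, fun f => ?_⟩
    · refine Fin.cases hw (fun j => ?_) j
      exact (Finset.mem_sdiff.mp (hr j)).1
    · rw [Fin.sum_univ_succ, ← Finset.sum_sdiff hOW, hsum, add_comm, hO,
        Finset.sum_image fun _ _ _ _ h => hinj h]
      simp

namespace SimpleGraph

variable {V : Type*} {Γ : SimpleGraph V} [DecidableRel Γ.Adj]

/-- The adjacency indicator with values in `ℕ`. -/
def adjInd (Γ : SimpleGraph V) [DecidableRel Γ.Adj] (u v : V) : ℕ := if Γ.Adj u v then 1 else 0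

theorem adjInd_comm (u v : V) : Γ.adjInd u v = Γ.adjInd v u := by
  simp [adjInd, Γ.adj_comm u v]

theorem adjInd_iso (g : Γ ≃g Γ) (u v : V) : Γ.adjInd (g u) (g v) = Γ.adjInd u v := by
  simp only [adjInd, iso_adj_iff]

variable [Fintype V]

theorem sum_nbrs_eq (x : V) (f : V → ℕ) :
    ∑ v ∈ Γ.neighborFinset x, f v = ∑ v, f v * Γ.adjInd v x := by
  rw [neighborFinset_eq_filter, Finset.sum_filter]
  refine Finset.sum_congr rfl fun v _ => ?_
  simp [adjInd, Γ.adj_comm v x]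

theorem IsSRGWith.sum_adjInd (hΓ : Γ.IsSRGWith 99 14 1 2) (u : V) : ∑ w, Γ.adjInd u w = 14 := by
  simp only [adjInd]
  rw [Finset.sum_boole, ← neighborFinset_eq_filter, card_neighborFinset_eq_degree, hΓ.regular u]
  rfl

variable [DecidableEq V]

/-- The vertices different from `x` and not adjacent to `x`. -/
def nonNbrs (Γ : SimpleGraph V) [DecidableRel Γ.Adj] (x : V) : Finset V :=
  Finset.univ.filter fun v => v ≠ x ∧ ¬ Γ.Adj x v

theorem mem_nonNbrs {x v : V} : v ∈ Γ.nonNbrs x ↔ v ≠ x ∧ ¬ Γ.Adj x v := by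
  simp [nonNbrs]

theorem sum_eq_add_nbrs_add_nonNbrs (Γ : SimpleGraph V) [DecidableRel Γ.Adj] (x : V)
    (f : V → ℕ) :
    ∑ v, f v = f x + ∑ v ∈ Γ.neighborFinset x, f v + ∑ v ∈ Γ.nonNbrs x, f v := by
  have h1 : Disjoint (Γ.neighborFinset x) (Γ.nonNbrs x) := by
    rw [Finset.disjoint_left]
    intro v hv hw
    exact (mem_nonNbrs.mp hw).2 ((mem_neighborFinset _ _ _).mp hv)
  rw [add_assoc, ← Finset.sum_union h1, ← Finset.sum_insert (by simp [mem_nonNbrs])]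
  congr 1
  ext v
  simp only [Finset.mem_univ, Finset.mem_insert, Finset.mem_union, mem_neighborFinset,
    mem_nonNbrs, true_iff]
  tauto

/-- The entries of A² + A = 2J + 12I, arranged so that no subtraction in ℕ occurs. -/
theorem IsSRGWith.sum_adjInd_mul (hΓ : Γ.IsSRGWith 99 14 1 2) (u v : V) :
    ∑ w, Γ.adjInd u w * Γ.adjInd w v + Γ.adjInd u v = 2 + if u = v then 12 else 0 := by
  have e : ∑ w, Γ.adjInd u w * Γ.adjInd w v =
      (Γ.neighborFinset u ∩ Γ.neighborFinset v).card := by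
    rw [Finset.card_eq_sum_ones, ← Finset.filter_mem_eq_inter, Finset.sum_filter,
      neighborFinset_eq_filter, Finset.sum_filter]
    refine Finset.sum_congr rfl fun w _ => ?_
    simp only [adjInd, mem_neighborFinset, Γ.adj_comm w v]
    split_ifs <;> simp
  rw [e, hΓ.card_inter]
  by_cases h1 : u = v
  · subst h1; simp [adjInd]
  · by_cases h2 : Γ.Adj u v <;> simp [adjInd, h1, h2]

theorem IsSRGWith.card_nonNbrs (hΓ : Γ.IsSRGWith 99 14 1 2) (x : V) :
    (Γ.nonNbrs x).card = 84 := by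
  have h := sum_eq_add_nbrs_add_nonNbrs Γ x fun _ => 1
  have h14 : (Γ.neighborFinset x).card = 14 := hΓ.regular x
  simp only [Finset.sum_const, Finset.card_univ, hΓ.card, h14, smul_eq_mul, mul_one] at h
  omega

theorem IsSRGWith.sum_nbrs_adjInd (hΓ : Γ.IsSRGWith 99 14 1 2) {x u : V} (hu : u ∈ Γ.nonNbrs x) :
    ∑ y ∈ Γ.neighborFinset x, Γ.adjInd u y = 2 := by
  rw [mem_nonNbrs] at hu
  have h := hΓ.sum_adjInd_mul u x
  rw [sum_nbrs_eq]
  simpa [hu.1, adjInd, Γ.adj_comm u x, hu.2] using h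

theorem IsSRGWith.sum_nonNbrs_adjInd (hΓ : Γ.IsSRGWith 99 14 1 2) {x u : V}
    (hu : u ∈ Γ.nonNbrs x) : ∑ w ∈ Γ.nonNbrs x, Γ.adjInd u w = 12 := by
  have h := sum_eq_add_nbrs_add_nonNbrs Γ x (Γ.adjInd u)
  rw [hΓ.sum_adjInd, hΓ.sum_nbrs_adjInd hu] at h
  have : Γ.adjInd u x = 0 := by
    simp [adjInd, Γ.adj_comm u x, (mem_nonNbrs.mp hu).2]
  omega

/-- A transversal `N₀` of the pairs `{y, τ y}` of adjacent vertices in the neighbourhood of `x`. -/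
structure IsHalfNbhd (Γ : SimpleGraph V) [DecidableRel Γ.Adj] (x : V) (τ : Γ ≃g Γ)
    (N₀ : Finset V) : Prop where
  subset : N₀ ⊆ Γ.neighborFinset x
  card : N₀.card = 7
  notMem : ∀ y ∈ N₀, τ y ∉ N₀
  sum_eq : ∀ f : V → ℕ, ∑ y ∈ Γ.neighborFinset x, f y = ∑ y ∈ N₀, f y + ∑ y ∈ N₀, f (τ y)

section HalfNbhd

variable {x : V} {τ : Γ ≃g Γ} {N₀ : Finset V}

theorem IsSRGWith.adjInd_nbrs (hΓ : Γ.IsSRGWith 99 14 1 2) (hx : τ x = x)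
    (hadj : ∀ y, Γ.Adj x y → Γ.Adj y (τ y)) {y z : V} (hy : Γ.Adj x y) (hz : Γ.Adj x z) :
    Γ.adjInd z y = if z = τ y then 1 else 0 := by
  have hy2 := (iso_adj_iff τ).2 hy
  rw [hx] at hy2
  have : Γ.Adj z y ↔ z = τ y := by
    constructor
    · exact fun h => hΓ.eq_of_adj hy hz h.symm hy2 (hadj y hy)
    · rintro rfl
      exact (hadj y hy).symm
  simp only [adjInd, this]

theorem IsSRGWith.sum_nbrs_mul_adjInd (hΓ : Γ.IsSRGWith 99 14 1 2) (hx : τ x = x)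
    (hadj : ∀ y, Γ.Adj x y → Γ.Adj y (τ y)) {y : V} (hy : Γ.Adj x y) (f : V → ℕ) :
    ∑ z ∈ Γ.neighborFinset x, f z * Γ.adjInd z y = f (τ y) := by
  have hy2 := (iso_adj_iff τ).2 hy
  rw [hx] at hy2
  rw [Finset.sum_congr rfl fun z hz => by
    rw [hΓ.adjInd_nbrs hx hadj hy ((mem_neighborFinset _ _ _).mp hz)]]
  simp [hy2]

/-- Summing A² + A over the seven columns in N₀ gives 14; paths through N(x) together with the term
A contribute the two neighbours of u in N(x). -/
theorem IsSRGWith.sum_nonNbrs_mul_half (hΓ : Γ.IsSRGWith 99 14 1 2) (hx : τ x = x)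
    (hadj : ∀ y, Γ.Adj x y → Γ.Adj y (τ y)) (hN : Γ.IsHalfNbhd x τ N₀) {u : V}
    (hu : u ∈ Γ.nonNbrs x) :
    ∑ w ∈ Γ.nonNbrs x, Γ.adjInd u w * ∑ y ∈ N₀, Γ.adjInd w y = 12 := by
  have hux : Γ.adjInd u x = 0 := by
    simp [adjInd, Γ.adj_comm u x, (mem_nonNbrs.mp hu).2]
  have hterm : ∀ y ∈ N₀, ∑ w ∈ Γ.nonNbrs x, Γ.adjInd u w * Γ.adjInd w y +
      (Γ.adjInd u y + Γ.adjInd u (τ y)) = 2 := by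
    intro y hy
    have hxy : Γ.Adj x y := (mem_neighborFinset _ _ _).mp (hN.subset hy)
    have h := hΓ.sum_adjInd_mul u y
    have huy : u ≠ y := by
      rintro rfl
      exact (mem_nonNbrs.mp hu).2 hxy
    rw [sum_eq_add_nbrs_add_nonNbrs Γ x, hΓ.sum_nbrs_mul_adjInd hx hadj hxy, hux,
      if_neg huy] at h
    omega
  have htot := Finset.sum_congr rfl hterm
  have h2 := hΓ.sum_nbrs_adjInd hu
  rw [hN.sum_eq] at h2
  rw [Finset.sum_add_distrib, Finset.sum_add_distrib, h2, Finset.sum_const, hN.card,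
    Finset.sum_comm] at htot
  simp only [← Finset.mul_sum] at htot
  simpa using htot

/-- The paths y, w, τ z with y, z in N₀ and w in `nonNbrs` are counted: one if y ≠ z, none if y = z,
so 7 · 6. A vertex w with a and b neighbours in the two halves, a + b = 2, lies on ab of them, which
is 1 exactly when a = 1. -/
theorem IsSRGWith.card_balanced (hΓ : Γ.IsSRGWith 99 14 1 2) (hx : τ x = x)
    (hadj : ∀ y, Γ.Adj x y → Γ.Adj y (τ y)) (hN : Γ.IsHalfNbhd x τ N₀) :
    ((Γ.nonNbrs x).filter fun w => ∑ y ∈ N₀, Γ.adjInd w y = 1).card = 42 := by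
  have h1 : ∀ w ∈ Γ.nonNbrs x, (if ∑ y ∈ N₀, Γ.adjInd w y = 1 then 1 else 0) =
      (∑ y ∈ N₀, Γ.adjInd y w) * ∑ z ∈ N₀, Γ.adjInd w (τ z) := by
    intro w hw
    have h2 := hΓ.sum_nbrs_adjInd hw
    rw [hN.sum_eq] at h2
    simp only [fun y => adjInd_comm (Γ := Γ) y w]
    generalize ∑ y ∈ N₀, Γ.adjInd w y = a at *
    obtain ⟨rfl, h⟩ | ⟨rfl, h⟩ | ⟨rfl, h⟩ : (a = 0 ∧ ∑ y ∈ N₀, Γ.adjInd w (τ y) = 2) ∨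
      (a = 1 ∧ ∑ y ∈ N₀, Γ.adjInd w (τ y) = 1) ∨
      (a = 2 ∧ ∑ y ∈ N₀, Γ.adjInd w (τ y) = 0) := by omega
    all_goals simp [h]
  rw [Finset.card_filter, Finset.sum_congr rfl h1]
  simp only [Finset.sum_mul_sum]
  rw [Finset.sum_comm]
  have h2 : ∀ y ∈ N₀, (∑ w ∈ Γ.nonNbrs x, ∑ z ∈ N₀, Γ.adjInd y w * Γ.adjInd w (τ z)) = 6 := by
    intro y hy
    rw [Finset.sum_comm]
    have hxy : Γ.Adj x y := (mem_neighborFinset _ _ _).mp (hN.subset hy)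
    have h3 : ∀ z ∈ N₀, ∑ w ∈ Γ.nonNbrs x, Γ.adjInd y w * Γ.adjInd w (τ z) +
        (if y = z then 1 else 0) = 1 := by
      intro z hz
      have hxz : Γ.Adj x z := (mem_neighborFinset _ _ _).mp (hN.subset hz)
      have hxz' := (iso_adj_iff τ).2 hxz
      rw [hx] at hxz'
      have hne : y ≠ τ z := by
        rintro rfl
        exact hN.notMem z hz hy
      have h := hΓ.sum_adjInd_mul y (τ z)
      have e1 : Γ.adjInd y x = 1 := by simp [adjInd, hxy.symm]
      have e2 : Γ.adjInd x (τ z) = 1 := by simp [adjInd, hxz']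
      have e3 : Γ.adjInd y (τ z) = if y = z then 1 else 0 := by
        rw [adjInd_comm, hΓ.adjInd_nbrs hx hadj hxy hxz']
        simp [eq_comm]
      have e4 : Γ.adjInd y (τ (τ z)) = 0 := by
        have hxz2 := (iso_adj_iff τ).2 hxz'
        rw [hx] at hxz2
        rw [adjInd_comm, hΓ.adjInd_nbrs hx hadj hxy hxz2, if_neg]
        exact fun h => hne (τ.injective h).symm
      rw [sum_eq_add_nbrs_add_nonNbrs Γ x, hΓ.sum_nbrs_mul_adjInd hx hadj hxz', e1, e2, e3, e4,
        if_neg hne] at h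
      omega
    have h4 := Finset.sum_congr rfl h3
    rw [Finset.sum_add_distrib, Finset.sum_ite_eq, if_pos hy, Finset.sum_const, hN.card] at h4
    simpa using h4
  rw [Finset.sum_congr rfl h2, Finset.sum_const, hN.card]
  rfl

end HalfNbhd

end SimpleGraph

/-! ### The cyclic group of order fourteen and its quotient matrix. -/

namespace SimpleGraph

variable {V : Type*} [Fintype V] [DecidableEq V] {Γ : SimpleGraph V} [DecidableRel Γ.Adj]
  {x : V} {σ τ : Γ ≃g Γ}

/-- Otherwise g is an involution, or g² has order 7, with two fixed vertices. -/
theorem IsSRGWith.eq_one_of_pow_fourteen (hΓ : Γ.IsSRGWith 99 14 1 2) {g : Γ ≃g Γ}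
    (hg : g ^ 14 = 1) {v : V} (hx : g x = x) (hv : g v = v) (hne : v ≠ x) : g = 1 := by
  by_cases h2 : g ^ 2 = 1
  · by_contra h1
    obtain ⟨z, -, hz, -⟩ := hΓ.involution_structure (iso_involutive_of_sq h2) h1
    exact hne ((hz v hv).trans (hz x hx).symm)
  · obtain ⟨z, -, hz⟩ := hΓ.existsUnique_fixed_of_pow_seven
      (show (g ^ 2) ^ 7 = 1 by rw [← pow_mul, hg]) h2
    have hsq : ∀ w, g w = w → (g ^ 2) w = w := fun w hw => by
      rw [pow_two]; change g (g w) = w; rw [hw, hw]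
    exact absurd ((hz v (hsq v hv)).trans (hz x (hsq x hx)).symm) hne

theorem IsSRGWith.exists_isHalfNbhd (hΓ : Γ.IsSRGWith 99 14 1 2) (hσx : σ x = x) (hτx : τ x = x)
    (hσ : σ ^ 7 = 1) (hσ1 : σ ≠ 1) (hτ : τ ^ 2 = 1) (hτ1 : τ ≠ 1) (hcomm : σ * τ = τ * σ) :
    ∃ N₀, Γ.IsHalfNbhd x τ N₀ ∧ N₀.image σ = N₀ := by
  have h14 : (Γ.neighborFinset x).card = 14 := hΓ.regular x
  obtain ⟨y₀, hy₀⟩ := Finset.card_pos.mp (h14 ▸ (by norm_num) : 0 < (Γ.neighborFinset x).card)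
  rw [mem_neighborFinset] at hy₀
  have hσo : orderOf σ = 7 := by
    have : Fact (Nat.Prime 7) := ⟨by norm_num⟩
    exact orderOf_eq_prime hσ hσ1
  have hττ := iso_involutive_of_sq hτ
  have hpow : ∀ (n : ℕ), (σ ^ n) x = x := fun n => by
    rw [← iso_iterate]; exact Function.iterate_fixed hσx n
  have hpN : ∀ n : ℕ, Γ.Adj x ((σ ^ n) y₀) := fun n => by
    have := (iso_adj_iff (σ ^ n)).2 hy₀
    rwa [hpow] at this
  have hcm : ∀ n : ℕ, ∀ v, τ ((σ ^ n) v) = (σ ^ n) (τ v) := fun n v =>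
    congrArg (fun g : Γ ≃g Γ => g v) ((show Commute τ σ from hcomm.symm).pow_right n).eq
  have hmod : ∀ n : ℕ, σ ^ n = σ ^ (n % 7) := fun n => by rw [← hσo, pow_mod_orderOf]
  set N₀ := (Finset.range 7).image fun n => (σ ^ n) y₀ with hN₀
  have hmem : ∀ n : ℕ, (σ ^ n) y₀ ∈ N₀ := fun n => by
    rw [hmod]
    exact Finset.mem_image_of_mem _ (Finset.mem_range.mpr (Nat.mod_lt _ (by norm_num)))
  have hinj : Set.InjOn (fun n : ℕ => (σ ^ n) y₀) (Finset.range 7 : Finset ℕ) := by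
    have aux : ∀ m n : ℕ, m ≤ n → n < 7 → (σ ^ m) y₀ = (σ ^ n) y₀ → m = n := by
      intro m n hmn hn h
      obtain ⟨d, rfl⟩ := Nat.exists_eq_add_of_le hmn
      rw [pow_add] at h
      have h1 : y₀ = (σ ^ d) y₀ := (σ ^ m).injective h
      have h2 := hΓ.eq_one_of_pow_fourteen (g := σ ^ d)
        (by rw [← pow_mul, mul_comm, pow_mul, show 14 = 7 * 2 from rfl, pow_mul, hσ, one_pow,
          one_pow]) (hpow d) h1.symm hy₀.ne'
      rw [← orderOf_dvd_iff_pow_eq_one, hσo] at h2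
      omega
    intro m hm n hn h
    simp only [Finset.coe_range, Set.mem_Iio] at hm hn
    rcases le_total m n with h1 | h1
    · exact aux m n h1 hn h
    · exact (aux n m h1 hm h.symm).symm
  have hsub : N₀ ⊆ Γ.neighborFinset x := by
    intro v hv
    obtain ⟨n, -, rfl⟩ := Finset.mem_image.mp hv
    rw [mem_neighborFinset]
    exact hpN n
  have hcard : N₀.card = 7 := by
    rw [hN₀, Finset.card_image_of_injOn hinj, Finset.card_range]
  have hnot : ∀ y ∈ N₀, τ y ∉ N₀ := by
    intro y hy hτy
    obtain ⟨m, -, rfl⟩ := Finset.mem_image.mp hy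
    obtain ⟨n, -, hn⟩ := Finset.mem_image.mp hτy
    rw [hcm] at hn
    -- The exponent 6m stands for -m, since σ has order 7.
    have hfix : (τ * σ ^ (n + 6 * m)) y₀ = y₀ := by
      have : (σ ^ (6 * m)) ((σ ^ n) y₀) = τ y₀ := by
        rw [hn]
        change (σ ^ (6 * m) * σ ^ m) (τ y₀) = τ y₀
        rw [← pow_add, show 6 * m + m = 7 * m by ring, pow_mul, hσ, one_pow]
        rfl
      change τ ((σ ^ (n + 6 * m)) y₀) = y₀
      rw [add_comm, pow_add]
      change τ ((σ ^ (6 * m)) ((σ ^ n) y₀)) = y₀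
      rw [this, hττ]
    have hone := hΓ.eq_one_of_pow_fourteen (g := τ * σ ^ (n + 6 * m)) (by
      rw [((show Commute τ σ from hcomm.symm).pow_right _).mul_pow,
        show 14 = 2 * 7 from rfl, pow_mul, hτ, one_pow, one_mul, ← pow_mul,
        show (n + 6 * m) * (2 * 7) = 7 * ((n + 6 * m) * 2) by ring, pow_mul, hσ, one_pow])
      (show τ ((σ ^ (n + 6 * m)) x) = x by rw [hpow, hτx]) hfix hy₀.ne'
    have h7 : τ ^ 7 = 1 := by
      rw [eq_inv_of_mul_eq_one_left hone, inv_pow, ← pow_mul, mul_comm, pow_mul, hσ, one_pow,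
        inv_one]
    apply hτ1
    calc τ = τ ^ 7 * ((τ ^ 2) ^ 3)⁻¹ := by group
      _ = 1 := by rw [h7, hτ]; simp
  refine ⟨N₀, ⟨hsub, hcard, hnot, fun f => ?_⟩, ?_⟩
  · have hdisj : Disjoint N₀ (N₀.image τ) := by
      rw [Finset.disjoint_left]
      intro v hv hv2
      obtain ⟨w, hw, rfl⟩ := Finset.mem_image.mp hv2
      exact hnot w hw hv
    have himg : (N₀.image τ).card = 7 := by
      rw [Finset.card_image_of_injective _ τ.injective, hcard]
    have hunion : N₀ ∪ N₀.image τ = Γ.neighborFinset x := by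
      refine Finset.eq_of_subset_of_card_le (Finset.union_subset hsub ?_) ?_
      · intro v hv
        obtain ⟨w, hw, rfl⟩ := Finset.mem_image.mp hv
        have := (iso_adj_iff τ).2 ((mem_neighborFinset _ _ _).mp (hsub hw))
        rwa [hτx, ← mem_neighborFinset] at this
      · rw [Finset.card_union_of_disjoint hdisj, hcard, himg, h14]
    rw [← hunion, Finset.sum_union hdisj, Finset.sum_image fun _ _ _ _ h => τ.injective h]
  · refine Finset.eq_of_subset_of_card_le ?_ ?_
    · intro v hv
      obtain ⟨w, hw, rfl⟩ := Finset.mem_image.mp hv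
      obtain ⟨n, -, rfl⟩ := Finset.mem_image.mp hw
      have := hmem (n + 1)
      rwa [pow_succ'] at this
    · rw [Finset.card_image_of_injective _ σ.injective]

theorem IsSRGWith.no_commuting (hΓ : Γ.IsSRGWith 99 14 1 2) (hσx : σ x = x) (hτx : τ x = x)
    (hσ : σ ^ 7 = 1) (hσ1 : σ ≠ 1) (hτ : τ ^ 2 = 1) (hτ1 : τ ≠ 1) (hcomm : σ * τ = τ * σ)
    (hadj : ∀ y, Γ.Adj x y → Γ.Adj y (τ y)) : False := by
  obtain ⟨N₀, hN, hNσ⟩ := hΓ.exists_isHalfNbhd hσx hτx hσ hσ1 hτ hτ1 hcomm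
  have hττ := iso_involutive_of_sq hτ
  have hρo : orderOf (σ * τ) = 14 := by
    have : Fact (Nat.Prime 7) := ⟨by norm_num⟩
    have : Fact (Nat.Prime 2) := ⟨by norm_num⟩
    have h1 := orderOf_eq_prime hσ hσ1
    have h2 := orderOf_eq_prime hτ hτ1
    rw [(show Commute σ τ from hcomm).orderOf_mul_eq_mul_orderOf_of_coprime (by
      rw [h1, h2]; norm_num), h1, h2]
  set C := Subgroup.zpowers (σ * τ) with hC
  have : Finite (Γ ≃g Γ) := DFunLike.finite _
  have : Fintype C := Fintype.ofFinite C
  have hCcard : Fintype.card C = 14 := by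
    rw [← Nat.card_eq_fintype_card, hC, Nat.card_zpowers, hρo]
  have hCpow : ∀ g : C, ∃ n : ℕ, (σ * τ) ^ n = g := fun g =>
    Submonoid.mem_powers_iff _ _ |>.mp (mem_powers_iff_mem_zpowers.mpr g.2)
  have hC14 : ∀ g : C, (g : Γ ≃g Γ) ^ 14 = 1 := fun g => by
    rw [← Subgroup.coe_pow, ← hCcard, pow_card_eq_one, Subgroup.coe_one]
  have hCx : ∀ g : C, g • x = x := fun g => by
    obtain ⟨n, hn⟩ := hCpow g
    change (g : Γ ≃g Γ) x = x
    rw [← hn, ← iso_iterate]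
    exact Function.iterate_fixed (show σ (τ x) = x by rw [hτx, hσx]) n
  have hfree : ∀ (v : V) (g : C), v ≠ x → g • v = v → g = 1 := fun v g hv hg =>
    Subtype.ext (hΓ.eq_one_of_pow_fourteen (hC14 g) (hCx g) hg hv)
  have hCadj : ∀ (g : C) (u v : V), Γ.Adj (g • u) (g • v) ↔ Γ.Adj u v := fun g u v =>
    iso_adj_iff (g : Γ ≃g Γ)
  have hA : ∀ (g : C) (u v : V), Γ.adjInd (g • u) (g • v) = Γ.adjInd u v := fun g u v =>
    adjInd_iso (g : Γ ≃g Γ) u v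
  have hWinv : ∀ (g : C), ∀ w ∈ Γ.nonNbrs x, g • w ∈ Γ.nonNbrs x := by
    intro g w hw
    rw [mem_nonNbrs] at hw ⊢
    refine ⟨fun h => hw.1 ?_, fun h => hw.2 ?_⟩
    · rwa [smul_eq_iff_eq_inv_smul, hCx] at h
    · rwa [← hCx g, hCadj] at h
  obtain ⟨r, hrW, hrsum⟩ := Finset.exists_orbit_reps (G := C) 6 (Γ.nonNbrs x) hWinv
    (fun w hw g => hfree w g (mem_nonNbrs.mp hw).1) (by rw [hΓ.card_nonNbrs, hCcard])
  -- `C` is transitive on the neighbourhood of `x`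
  have htrans : ∀ (y : V), Γ.Adj x y → ∀ f : V → ℕ,
      ∑ g : C, f (g • y) = ∑ z ∈ Γ.neighborFinset x, f z := by
    intro y hy f
    have hinj : Function.Injective fun g : C => g • y := by
      intro g h hgh
      have : (h⁻¹ * g) • y = y := by
        rw [mul_smul, inv_smul_eq_iff]; exact hgh
      exact (inv_mul_eq_one.mp (hfree y _ hy.ne' this)).symm
    have himg : Finset.univ.image (fun g : C => g • y) = Γ.neighborFinset x := by
      refine Finset.eq_of_subset_of_card_le ?_ ?_
      · intro v hv
        obtain ⟨g, -, rfl⟩ := Finset.mem_image.mp hv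
        rw [mem_neighborFinset, ← hCx g, hCadj]
        exact hy
      · rw [Finset.card_image_of_injective _ hinj, Finset.card_univ, hCcard]
        exact (hΓ.regular x).le
    rw [← himg, Finset.sum_image fun _ _ _ _ h => hinj h]
  have hshift : ∀ (h : C) (u w : V),
      ∑ g : C, Γ.adjInd (h • u) (g • w) = ∑ g : C, Γ.adjInd u (g • w) := by
    intro h u w
    rw [← Equiv.sum_comp (Equiv.mulLeft h)]
    refine Finset.sum_congr rfl fun g _ => ?_
    rw [Equiv.coe_mulLeft, mul_smul, hA]
  set M : Fin 6 → Fin 6 → ℕ := fun j k => ∑ g : C, Γ.adjInd (r j) (g • r k) with hM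
  -- Applied to the indicator of r j, the orbit decomposition has total 1, already attained at the
  -- orbit of r j by the identity.
  have hδ : ∀ j l, ∑ g : C, (if r j = g • r l then 1 else 0) = if j = l then 1 else 0 := by
    intro j
    have htot := hrsum fun w => if r j = w then 1 else 0
    rw [Finset.sum_ite_eq, if_pos (hrW j)] at htot
    have hj : 1 ≤ ∑ g : C, (if r j = g • r j then 1 else 0) := by
      have := Finset.single_le_sum (f := fun g : C => if r j = g • r j then 1 else 0)
        (fun _ _ => Nat.zero_le _) (Finset.mem_univ 1)
      simpa using this
    rw [← Finset.add_sum_erase _ _ (Finset.mem_univ j)] at htot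
    intro l
    split_ifs with h
    · subst h; omega
    · have hz : ∑ k ∈ Finset.univ.erase j, ∑ g : C, (if r j = g • r k then 1 else 0) = 0 := by
        omega
      exact (Finset.sum_eq_zero_iff.mp hz) l (by simp [Ne.symm h])
  set X := (Γ.nonNbrs x).filter fun w => ∑ y ∈ N₀, Γ.adjInd w y = 1 with hX
  -- σ preserves N₀ while τ interchanges the two halves, and a vertex of X has one neighbour in
  -- each.
  have hXstep : ∀ w ∈ X, (σ * τ) w ∈ X := by
    intro w hw
    rw [hX, Finset.mem_filter] at hw ⊢
    refine ⟨hWinv ⟨σ * τ, Subgroup.mem_zpowers _⟩ w hw.1, ?_⟩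
    have h2 := hΓ.sum_nbrs_adjInd hw.1
    rw [hN.sum_eq, hw.2] at h2
    rw [← hNσ, Finset.sum_image fun _ _ _ _ h => σ.injective h]
    have : ∀ y, Γ.adjInd ((σ * τ) w) (σ y) = Γ.adjInd w (τ y) := by
      intro y
      change Γ.adjInd (σ (τ w)) (σ y) = _
      rw [adjInd_iso, ← adjInd_iso τ, hττ]
    simp only [this]
    omega
  have hXinv : ∀ (g : C), ∀ w ∈ X, g • w ∈ X := by
    intro g w hw
    obtain ⟨n, hn⟩ := hCpow g
    change (g : Γ ≃g Γ) w ∈ X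
    rw [← hn]
    clear hn
    induction n with
    | zero => exact hw
    | succ n ih => rw [pow_succ']; exact hXstep _ ih
  have hXiff : ∀ (g : C) (w : V), g • w ∈ X ↔ w ∈ X := fun g w =>
    ⟨fun h => by simpa using hXinv g⁻¹ _ h, hXinv g w⟩
  set t : Fin 6 → ℕ := fun j => if r j ∈ X then 1 else 0 with ht
  refine no_quotient_matrix (M := M) ?_ ?_ ?_ ?_ t ?_ ?_ ?_
  · intro j k
    simp only [hM]
    rw [← Equiv.sum_comp (Equiv.inv C)]
    refine Finset.sum_congr rfl fun g _ => ?_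
    rw [Equiv.inv_apply, ← hA g, smul_inv_smul, adjInd_comm]
  · intro j
    rw [← hΓ.sum_nonNbrs_adjInd (hrW j), hrsum]
  · intro j l
    -- Summed over C, the right-hand side gives 14 · 2 = 28; paths through N(x) account for 2 · 2,
    -- leaving 24.
    have hone : ∀ g : C, ∑ w ∈ Γ.nonNbrs x, Γ.adjInd (r j) w * Γ.adjInd w (g • r l) +
        ∑ y ∈ Γ.neighborFinset x, Γ.adjInd (r j) y * Γ.adjInd y (g • r l) +
        Γ.adjInd (r j) (g • r l) = 2 + 12 * if r j = g • r l then 1 else 0 := by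
      intro g
      have h := hΓ.sum_adjInd_mul (r j) (g • r l)
      have hz : Γ.adjInd (r j) x = 0 := by
        simp [adjInd, Γ.adj_comm _ x, (mem_nonNbrs.mp (hrW j)).2]
      rw [sum_eq_add_nbrs_add_nonNbrs Γ x, hz, zero_mul, zero_add] at h
      split_ifs at h ⊢ <;> omega
    have hsum := Finset.sum_congr (rfl : (Finset.univ : Finset C) = Finset.univ)
      fun g _ => hone g
    rw [Finset.sum_add_distrib, Finset.sum_add_distrib, Finset.sum_add_distrib,
      ← Finset.mul_sum, hδ, Finset.sum_const, Finset.card_univ, hCcard] at hsum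
    have h1 : ∑ g : C, ∑ w ∈ Γ.nonNbrs x, Γ.adjInd (r j) w * Γ.adjInd w (g • r l) =
        ∑ k, M j k * M k l := by
      rw [Finset.sum_comm]
      simp only [← Finset.mul_sum]
      rw [hrsum]
      simp only [hshift, ← Finset.sum_mul]
      rfl
    have h2 : ∑ g : C, ∑ y ∈ Γ.neighborFinset x, Γ.adjInd (r j) y * Γ.adjInd y (g • r l) = 2 * 2 := by
      rw [Finset.sum_comm]
      simp only [← Finset.mul_sum]
      have h3 : ∀ y ∈ Γ.neighborFinset x, Γ.adjInd (r j) y * ∑ g : C, Γ.adjInd y (g • r l) =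
          Γ.adjInd (r j) y * 2 := by
        intro y hy
        rw [mem_neighborFinset] at hy
        rw [← hΓ.sum_nbrs_adjInd (hrW l), ← htrans y hy, ← Equiv.sum_comp (Equiv.inv C)]
        congr 1
        refine Finset.sum_congr rfl fun g _ => ?_
        rw [Equiv.inv_apply, ← hA g, smul_inv_smul, adjInd_comm]
      rw [Finset.sum_congr rfl h3, ← Finset.sum_mul, hΓ.sum_nbrs_adjInd (hrW j)]
    rw [h1, h2] at hsum
    have h4 : ∑ g : C, Γ.adjInd (r j) (g • r l) = M j l := rfl
    rw [h4] at hsum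
    split_ifs at hsum ⊢ <;> simp at hsum <;> omega
  · intro j
    have hMc : M j j = (Finset.univ.filter fun g : C => Γ.Adj (r j) (g • r j)).card := by
      rw [Finset.card_filter]; rfl
    rw [hMc]
    -- If g = g⁻¹ were in the set, the common neighbour of r j and g • r j would be fixed by the
    -- involution g, so it would be x.
    refine Finset.even_card_of_fixedPointFree _ (fun g => g⁻¹) ?_ (fun g _ => inv_inv g) ?_
    · intro g hg
      simp only [Finset.mem_filter, Finset.mem_univ, true_and] at hg ⊢
      rw [← hCadj g, smul_inv_smul]
      exact hg.symm
    · intro g hg hgi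
      simp only [Finset.mem_filter, Finset.mem_univ, true_and] at hg
      have hsq : (g : Γ ≃g Γ) ^ 2 = 1 := by
        rw [← Subgroup.coe_pow, pow_two]
        nth_rw 1 [← hgi]
        simp
      have hg1 : (g : Γ ≃g Γ) ≠ 1 := by
        intro h
        have : g = 1 := Subtype.ext h
        rw [this, one_smul] at hg
        exact hg.ne rfl
      have hgg := iso_involutive_of_sq hsq
      obtain ⟨z, hz, hz1, -⟩ := hΓ.involution_structure hgg hg1
      obtain ⟨w, w1, w2, w3⟩ := hΓ.exists_common_of_adj hg
      have hw : (g : Γ ≃g Γ) w = w := by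
        refine w3 _ ?_ ((hCadj g _ _).2 w1)
        have := (hCadj g _ _).2 w2
        rwa [show g • g • r j = r j from hgg (r j)] at this
      have hwx : w = x := (hz1 w hw).trans (hz1 x (hCx g)).symm
      rw [hwx] at w1
      exact (mem_nonNbrs.mp (hrW j)).2 w1.symm
  · intro j
    simp only [ht]
    split_ifs <;> simp
  · have h42 := hΓ.card_balanced hτx hadj hN
    have h1 : (42 : ℕ) = ∑ w ∈ Γ.nonNbrs x, if w ∈ X then 1 else 0 := by
      rw [← h42, Finset.sum_boole, Nat.cast_id]
      congr 1
      ext w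
      simp only [hX, Finset.mem_filter]
      tauto
    rw [hrsum] at h1
    simp only [hXiff, Finset.sum_const, Finset.card_univ, hCcard, smul_eq_mul] at h1
    rw [← Finset.mul_sum] at h1
    simp only [ht]
    omega
  · intro j
    have h1 : ∑ k, t k * M j k =
        ∑ w ∈ Γ.nonNbrs x, Γ.adjInd (r j) w * if w ∈ X then 1 else 0 := by
      rw [hrsum]
      refine Finset.sum_congr rfl fun k _ => ?_
      simp only [hXiff, ht, hM]
      rw [← Finset.sum_mul, mul_comm]
    have h2 := hΓ.sum_nonNbrs_mul_half hτx hadj hN (hrW j)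
    -- The weight of w, its number of neighbours in N₀, is 0, 1 or 2, hence congruent modulo 2 to
    -- the indicator of X. The weighted sum is 12, which is even.
    have h3 : ∀ w ∈ Γ.nonNbrs x, Γ.adjInd (r j) w * ∑ y ∈ N₀, Γ.adjInd w y =
        (Γ.adjInd (r j) w * if w ∈ X then 1 else 0) +
          2 * (Γ.adjInd (r j) w * ((∑ y ∈ N₀, Γ.adjInd w y) / 2)) := by
      intro w hw
      have h4 := hΓ.sum_nbrs_adjInd hw
      rw [hN.sum_eq] at h4
      have h5 : w ∈ X ↔ ∑ y ∈ N₀, Γ.adjInd w y = 1 := by simp [hX, hw]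
      simp only [h5]
      generalize ∑ y ∈ N₀, Γ.adjInd w y = a at *
      have : a ≤ 2 := by omega
      interval_cases a <;> simp [mul_comm]
    rw [Finset.sum_congr rfl h3, Finset.sum_add_distrib, ← Finset.mul_sum, ← h1] at h2
    rw [Nat.even_iff]
    omega

end SimpleGraph

theorem proposition4p1 {V : Type*} [Fintype V] (Γ : SimpleGraph V) [DecidableRel Γ.Adj]
    (hΓ : Γ.IsSRGWith 99 14 1 2) :
    ¬ 14 ∣ Nat.card (Γ ≃g Γ) := by
  classical
  intro h
  obtain ⟨x, σ, τ, h1, h2, h3, h4, h5, h6, h7, h8⟩ := hΓ.exists_commuting h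
  exact hΓ.no_commuting h1 h2 h3 h4 h5 h6 h7 h8
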